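/- Let $n$ be even. For a subspace $A\le\mathbb F_2^n$ of dimension $n/2$ let $A^\perp=\{y:\ x\cdot y=0\ \text{for all }x\in A\}$, let $|A\rangle=|A|^{-1/2}\sum_{x\in A}|x\rangle$, and let $U_{A^*}$ be the oracle on $n+1$ qubits that multiplies the basis state $|b\rangle|x\rangle$ ($b\in\{0,1\}$, $x\in\mathbb F_2^n$) by $-1$ if $b=0$ and $x\in A$, or if $b=1$ and $x\in A^\perp$, and fixes it otherwise; thus $U_{A^*}$ combines the membership oracles for $A$ and $A^\perp$. Let $\mathcal S_n$ be the set of all $n/2$-dimensional subspaces of $\mathbb F_2^n$. A counterfeiter with $T$ queries is a quantum algorithm whose memory consists of $2n+1$ qubits and a workspace of any finite dimension. It starts with one copy of $|A\rangle$ and with the rest of its memory in a fixed basis state, applies $T+1$ arbitrary unitaries that do not depend on $A$, with one application of $U_{A^*}$ to $n+1$ fixed qubits between any two consecutive ones, and outputs the reduced $2n$-qubit state $\rho_A$ of two fixed $n$-qubit registers. Then: 1. (Perfect counterfeiting, worst case.) There is a constant $c>0$ such that for all sufficiently large even $n$, every counterfeiter with $\rho_A=(|A\rangle\langle A|)^{\otimes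 2}$ for all $A\in\mathcal S_n$ makes $T\ge c\,2^{n/4}$ queries. 2. (Small error, worst case.) There is a constant $c>0$ such that for all sufficiently large even $n$, every counterfeiter with $\langle A|^{\otimes 2}\rho_A|A\rangle^{\otimes 2}\ge 0.9999$ for all $A\in\mathcal S_n$ makes $T\ge c\,2^{n/4}$ queries. 3. (High error, worst case.) There is a constant $c>0$ such that for every function $\varepsilon:\mathbb N\to(0,\infty)$ with $1/\varepsilon(n)=o(2^{n/2})$ and all sufficiently large even $n$ (depending on $\varepsilon$), every counterfeiter with $\langle A|^{\otimes 2}\rho_A|A\rangle^{\otimes 2}\ge\varepsilon(n)$ for all $A\in\mathcal S_n$ makes $T\ge c\sqrt{\varepsilon(n)}\,2^{n/4}$ queries. 4. (Average case.) There is a constant $c>0$ such that for every function $\varepsilon:\mathbb N\to(0,\infty)$ with $1/\varepsilon(n)=o(2^{n/2})$ and all sufficiently large even $n$ (depending on $\varepsilon$), every counterfeiter whose output $\rho_A$, for a uniformly random $A\in\mathcal S_n$, is accepted by the measurement with projector $(|A\rangle\langle A|)^{\otimes 2}$ with probability at least $\varepsilon(n)$, the probability being over both $A$ and the measurement, makes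 $T\ge c\sqrt{\varepsilon(n)}\,2^{n/4}$ queries. -/

import Mathlib

open Filter Asymptotics
open scoped Kronecker

namespace SubspaceMoney

/-- The space `F_2^n` of `n`-bit strings; it labels the computational basis of `n` qubits. -/
abbrev Str (n : ℕ) : Type := Fin n → ZMod 2

/-- The orthogonal complement of `A ≤ F_2^n` with respect to the dot product over `F_2`. -/
def perp {n : ℕ} (A : Submodule (ZMod 2) (Str n)) : Submodule (ZMod 2) (Str n) where
  carrier := {y | ∀ x ∈ A, x ⬝ᵥ y = 0}
  add_mem' := by
    intro y z hy hz x hx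
    rw [dotProduct_add, hy x hx, hz x hx, add_zero]
  zero_mem' := by
    intro x _
    exact dotProduct_zero x
  smul_mem' := by
    intro a y hy x hx
    rw [dotProduct_smul, hy x hx, smul_zero]

/-- The set of all subspaces of `F_2^n` of dimension `n / 2` (used for even `n`). -/
abbrev HalfSubspace (n : ℕ) : Type :=
  {A : Submodule (ZMod 2) (Str n) // Module.finrank (ZMod 2) A = n / 2}

noncomputable instance instFintypeHalfSubspace (n : ℕ) : Fintype (HalfSubspace n) :=
  Fintype.ofFinite _

open Classical in
/-- The subspace state `|A⟩ = |A|^{-1/2} ∑_{x ∈ A} |x⟩`, as a vector of amplitudes. -/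
noncomputable def ket {n : ℕ} (A : Submodule (ZMod 2) (Str n)) : Str n → ℂ :=
  fun x => if x ∈ A then (((Real.sqrt (Nat.card A : ℝ))⁻¹ : ℝ) : ℂ) else 0

/-- The state `|A⟩ ⊗ |A⟩` of `2n` qubits. -/
noncomputable def ketTwo {n : ℕ} (A : Submodule (ZMod 2) (Str n)) : Str n × Str n → ℂ :=
  fun p => ket A p.1 * ket A p.2

/-- The projector `V_A = |A⟩⟨A|`. -/
noncomputable def verifier {n : ℕ} (A : Submodule (ZMod 2) (Str n)) :
    Matrix (Str n) (Str n) ℂ :=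
  Matrix.vecMulVec (ket A) (star (ket A))

/-- The projector `V_A ⊗ V_A = (|A⟩⟨A|)^{⊗2}` onto `|A⟩^{⊗2}`. -/
noncomputable def verifierTwo {n : ℕ} (A : Submodule (ZMod 2) (Str n)) :
    Matrix (Str n × Str n) (Str n × Str n) ℂ :=
  verifier A ⊗ₖ verifier A

/-- `A* = (0, A) ∪ (1, A^⊥)`, a set of `(n+1)`-bit strings. -/
def starSet {n : ℕ} (A : Submodule (ZMod 2) (Str n)) : Set (ZMod 2 × Str n) :=
  {p | (p.1 = 0 ∧ p.2 ∈ A) ∨ (p.1 = 1 ∧ p.2 ∈ perp A)}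

open Classical in
/-- The oracle `U_{A*}` on `n + 1` qubits: it multiplies the basis state `|p⟩` by `-1` if
`p ∈ A*` and fixes it otherwise.  On `|0⟩|x⟩` it is the membership oracle of `A`, and on
`|1⟩|x⟩` that of `A^⊥`. -/
noncomputable def oracle {n : ℕ} (A : Submodule (ZMod 2) (Str n)) :
    Matrix (ZMod 2 × Str n) (ZMod 2 × Str n) ℂ :=
  Matrix.diagonal fun p => if p ∈ starSet A then -1 else 1

/-- Labels `((b, x), (y, w))` of the basis states of a counterfeiter's memory: one qubit `b`, two
`n`-qubit registers `x` and `y`, and a workspace `w`.  Queries act on the registers `(b, x)`. -/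
abbrev Memory (n : ℕ) (W : Type) : Type := (ZMod 2 × Str n) × (Str n × W)

/-- A quantum query algorithm on `2n + 1` qubits and a workspace of arbitrary finite dimension
(with basis `Work`, initialized to `|start⟩`).  It makes `queries` oracle queries, and applies
arbitrary unitaries `gate 0, …, gate queries` before, between and after them, which do not depend
on the oracle (later entries of the sequence `gate` are not used). Measurements and random choices
are covered by deferring them to the final partial trace. -/
structure Counterfeiter (n : ℕ) where
  Work : Type
  [fintypeWork : Fintype Work]
  [decEqWork : DecidableEq Work]
  start : Work
  queries : ℕ
  gate : ℕ → Matrix.unitaryGroup (Memory n Work) ℂ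

attribute [instance] Counterfeiter.fintypeWork Counterfeiter.decEqWork

namespace Counterfeiter

variable {n : ℕ}

/-- The initial state: one copy of `|A⟩` in register `x`, and `|0⟩|0⟩|start⟩` elsewhere. -/
noncomputable def initial (C : Counterfeiter n) (A : Submodule (ZMod 2) (Str n)) :
    Memory n C.Work → ℂ :=
  fun m => if m.1.1 = 0 ∧ m.2.1 = 0 ∧ m.2.2 = C.start then ket A m.1.2 else 0

/-- The state after `t` queries to `U_{A*}` and the unitary that follows the `t`-th query. -/
noncomputable def stateAfter (C : Counterfeiter n) (A : Submodule (ZMod 2) (Str n)) :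
    ℕ → (Memory n C.Work → ℂ)
  | 0 => (C.gate 0 : Matrix (Memory n C.Work) (Memory n C.Work) ℂ).mulVec (C.initial A)
  | t + 1 => (C.gate (t + 1) : Matrix (Memory n C.Work) (Memory n C.Work) ℂ).mulVec
      ((oracle A ⊗ₖ (1 : Matrix (Str n × C.Work) (Str n × C.Work) ℂ)).mulVec (C.stateAfter A t))

/-- The final pure state of the whole memory. -/
noncomputable def final (C : Counterfeiter n) (A : Submodule (ZMod 2) (Str n)) :
    Memory n C.Work → ℂ :=
  C.stateAfter A C.queries

/-- The `2n`-qubit output: the reduced density matrix of the registers `x` and `y` in the final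
state, all other registers being traced out. -/
noncomputable def output (C : Counterfeiter n) (A : Submodule (ZMod 2) (Str n)) :
    Matrix (Str n × Str n) (Str n × Str n) ℂ :=
  fun p q => ∑ b : ZMod 2, ∑ w : C.Work,
    C.final A ((b, p.1), (p.2, w)) * star (C.final A ((b, q.1), (q.2, w)))

/-- `⟨A|^{⊗2} ρ |A⟩^{⊗2}`, where `ρ` is the output on `A`. -/
noncomputable def overlap (C : Counterfeiter n) (A : Submodule (ZMod 2) (Str n)) : ℝ :=
  (star (ketTwo A) ⬝ᵥ (C.output A).mulVec (ketTwo A)).re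

/-- The probability that the measurement with projector `V_A^{⊗2}` accepts the output on `A`. -/
noncomputable def acceptProb (C : Counterfeiter n) (A : Submodule (ZMod 2) (Str n)) : ℝ :=
  (verifierTwo A * C.output A).trace.re

/-- The probability that `V_A^{⊗2}` accepts the output, for a uniformly random `A` of dimension
`n / 2`. -/
noncomputable def averageAcceptProb (C : Counterfeiter n) : ℝ :=
  (∑ A : HalfSubspace n, C.acceptProb A.1) / (Fintype.card (HalfSubspace n) : ℝ)

end Counterfeiter

end SubspaceMoney

/-!
The hidden subspace `A` is put into a register of its own, in uniform superposition, so that a run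
of the counterfeiter becomes the evolution of one joint state. For every basis state of the memory,
the amplitude is then a function of `A`. Initially all these functions lie in the span
`memberSpan n` of the membership functions `A ↦ [y ∈ A]`: one copy of `|A⟩` carries no more than one
random element of `A`. The gates, which do not depend on `A`, preserve this property. Let
`Q = 2 ^ (n / 2)`. Two estimates give the lower bound.

* A query moves a joint state out of the span by a relative error of at most `4 / √Q`
  (`exists_near_oracle`). It multiplies the amplitudes by `1 - 2 [x ∈ A]`, or by
  `1 - 2 [x ∈ A^⊥]`. The product `[x ∈ A] [y ∈ A]` is again in the span if `x` and `y` are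
  dependent, and is shorter than `[y ∈ A]` by a factor of about `√Q` if they are independent. The
  general linear group acts transitively on independent tuples, so all Gram matrices are explicit
  (`sum_prod_ind`), and the estimate passes from single products to linear combinations. The second
  case reduces to the first, since `A ↦ A^⊥` preserves the span: `[x ∈ A^⊥]` is a combination of
  the `[y ∈ A]` (`ind_perp_mem_memberSpan`).
* A state in the span has at most the fraction `32 / Q` of its squared norm on `|A⟩ ⊗ |A⟩`
  (`sum_sq_norm_accept_le`). This follows from Schur's test and the bounded third moment of
  `|A ∩ B|` for a random `B` (`sum_card_inf_cube_le`).

After `T` queries the amplitude of acceptance is therefore at most `(6 + 4 T) / √Q`, so the average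
acceptance probability is at most `(6 + 4 T) ^ 2 / Q` (`averageAcceptProb_le`). If this probability
is at least `ε` and `ε Q` is large, which is what `1 / ε = o(Q)` provides, then `T` is at least a
constant times `√(ε Q)`. The worst cases follow from the average case, those with constant error by
taking `ε` constant.
-/

namespace SubspaceMoney

/-! ### Counting linearly independent tuples in half-dimensional subspaces -/

open Classical in
/-- The indicator of `y ∈ S`. For fixed `y` it is used as a function of the hidden subspace. -/
noncomputable def ind {n : ℕ} (y : Str n) (S : Submodule (ZMod 2) (Str n)) : ℝ :=
  if y ∈ S then 1 else 0

section Indicator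

variable {n : ℕ} (x y : Str n) (S T : Submodule (ZMod 2) (Str n))

lemma ind_congr {x y : Str n} {S T : Submodule (ZMod 2) (Str n)} (h : x ∈ S ↔ y ∈ T) :
    ind x S = ind y T := by
  classical exact if_congr h rfl rfl

lemma ind_zero : ind 0 S = 1 := by simp [ind]

lemma ind_mul_self : ind y S * ind y S = ind y S := by
  unfold ind; split_ifs <;> simp

lemma ind_nonneg : 0 ≤ ind y S := by
  unfold ind; split_ifs <;> simp

lemma ind_inf : ind y (S ⊓ T) = ind y S * ind y T := by
  by_cases hS : y ∈ S <;> by_cases hT : y ∈ T <;> simp [ind, hS, hT]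

lemma ind_mul_ind_add : ind x S * ind (y + x) S = ind x S * ind y S := by
  by_cases hx : x ∈ S
  · rw [ind_congr (S.add_mem_iff_left hx)]
  · simp [ind, hx]

lemma sum_ind_eq_card : ∑ y, ind y S = 2 ^ Module.finrank (ZMod 2) S := by
  classical
  have h := Module.card_eq_pow_finrank (K := ZMod 2) (V := S)
  simp only [ind, Finset.sum_boole, ← Fintype.card_subtype]
  rw [ZMod.card] at h
  exact_mod_cast h

end Indicator

/-- The number of linearly independent `k`-tuples in a space of dimension `d` over `F_2`. -/
noncomputable def tupleNum (d k : ℕ) : ℝ := ∏ i : Fin k, ((2 : ℝ) ^ d - 2 ^ (i : ℕ))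

/-- Beyond the dimension of `S` both sides vanish, so that no hypothesis on `k` is needed. -/
lemma card_independent_tuples {n : ℕ} (S : Submodule (ZMod 2) (Str n)) (k : ℕ) :
    (Nat.card {v : Fin k → Str n // LinearIndependent (ZMod 2) v ∧ ∀ i, v i ∈ S} : ℝ) =
      tupleNum (Module.finrank (ZMod 2) S) k := by
  have e : {v : Fin k → Str n // LinearIndependent (ZMod 2) v ∧ ∀ i, v i ∈ S} ≃
      {s : Fin k → S // LinearIndependent (ZMod 2) s} :=
    { toFun := fun v => ⟨fun i => ⟨v.1 i, v.2.2 i⟩,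
        LinearIndependent.of_comp S.subtype (by simpa [Function.comp_def] using v.2.1)⟩
      invFun := fun s => ⟨fun i => s.1 i,
        s.2.map' S.subtype (by simp), fun i => (s.1 i).2⟩
      left_inv := fun v => rfl
      right_inv := fun s => rfl }
  rw [Nat.card_congr e]
  by_cases hk : k ≤ Module.finrank (ZMod 2) S
  · rw [card_linearIndependent hk]
    push_cast
    refine Finset.prod_congr rfl fun i _ => ?_
    have : 2 ^ (i : ℕ) ≤ 2 ^ Module.finrank (ZMod 2) S :=
      Nat.pow_le_pow_right (by norm_num) (i.2.le.trans hk)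
    simp [Nat.cast_sub this]
  · have : IsEmpty {s : Fin k → S // LinearIndependent (ZMod 2) s} :=
      ⟨fun s => hk (by simpa using s.2.fintype_card_le_finrank)⟩
    rw [Nat.card_of_isEmpty]
    push Not at hk
    rw [tupleNum, Finset.prod_eq_zero (Finset.mem_univ ⟨_, hk⟩) (by simp)]
    simp

/-- A linear automorphism of `F_2^n` permutes the subspaces of dimension `n / 2`. -/
noncomputable def mapHalf {n : ℕ} (g : Str n ≃ₗ[ZMod 2] Str n) :
    HalfSubspace n ≃ HalfSubspace n where
  toFun A := ⟨A.1.map (g : Str n →ₗ[ZMod 2] Str n), by rw [LinearEquiv.finrank_map_eq, A.2]⟩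
  invFun A := ⟨A.1.map (g.symm : Str n →ₗ[ZMod 2] Str n), by
    rw [LinearEquiv.finrank_map_eq, A.2]⟩
  left_inv A := by
    ext x
    simp
  right_inv A := by
    ext x
    simp

lemma ind_mapHalf {n : ℕ} (g : Str n ≃ₗ[ZMod 2] Str n) (y : Str n) (A : HalfSubspace n) :
    ind (g y) (mapHalf g A).1 = ind y A.1 := by
  have : g y ∈ (mapHalf g A).1 ↔ y ∈ A.1 := by
    simp [mapHalf]
  exact ind_congr this

lemma exists_linearEquiv_of_independent {n k : ℕ} {v w : Fin k → Str n}
    (hv : LinearIndependent (ZMod 2) v) (hw : LinearIndependent (ZMod 2) w) :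
    ∃ g : Str n ≃ₗ[ZMod 2] Str n, ∀ i, g (v i) = w i := by
  obtain ⟨g, hg⟩ := Submodule.exists_linearEquiv_restrict_eq
    ((Module.Basis.span hv).equiv (Module.Basis.span hw) (Equiv.refl _))
  refine ⟨g, fun i => ?_⟩
  have h := hg (Module.Basis.span hv i)
  rw [Module.Basis.equiv_apply] at h
  simpa [Module.Basis.span_apply] using h.symm

/-- The number of subspaces of dimension `n / 2` containing a given linearly independent
`k`-tuple, in the closed form that `sum_prod_ind` justifies. -/
noncomputable def supNum (n k : ℕ) : ℝ :=
  (Fintype.card (HalfSubspace n) : ℝ) * tupleNum (n / 2) k / tupleNum n k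

lemma tupleNum_pos {d k : ℕ} (h : k ≤ d) : 0 < tupleNum d k := by
  refine Finset.prod_pos fun i _ => sub_pos.2 ?_
  exact pow_lt_pow_right₀ (by norm_num) (i.2.trans_le h)

open Classical in
lemma tupleNum_finrank_eq_sum {n : ℕ} (S : Submodule (ZMod 2) (Str n)) (k : ℕ) :
    tupleNum (Module.finrank (ZMod 2) S) k =
      ∑ v : Fin k → Str n, if LinearIndependent (ZMod 2) v then ∏ i, ind (v i) S else 0 := by
  rw [← card_independent_tuples S k, Nat.card_eq_fintype_card, Fintype.card_subtype,
    ← Finset.sum_boole]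
  refine Finset.sum_congr rfl fun v _ => ?_
  by_cases hv : LinearIndependent (ZMod 2) v
  · by_cases hA : ∀ i, v i ∈ S
    · simp [hv, hA, ind]
    · push Not at hA
      obtain ⟨i, hi⟩ := hA
      rw [if_neg (fun h => hi (h.2 i)), if_pos hv,
        Finset.prod_eq_zero (Finset.mem_univ i) (by simp [ind, hi])]
  · simp [hv]

/-- Double counting: the count does not depend on the tuple, because the general linear group acts
transitively on linearly independent `k`-tuples. -/
lemma sum_prod_ind {n k : ℕ} {v : Fin k → Str n} (hv : LinearIndependent (ZMod 2) v) :
    ∑ A : HalfSubspace n, ∏ i, ind (v i) A.1 = supNum n k := by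
  classical
  have hkn : k ≤ n := by simpa using hv.fintype_card_le_finrank
  have hconst : ∀ w : Fin k → Str n, LinearIndependent (ZMod 2) w →
      ∑ A : HalfSubspace n, ∏ i, ind (w i) A.1 = ∑ A : HalfSubspace n, ∏ i, ind (v i) A.1 := by
    intro w hw
    obtain ⟨g, hg⟩ := exists_linearEquiv_of_independent hv hw
    rw [← Equiv.sum_comp (mapHalf g)]
    refine Finset.sum_congr rfl fun A _ => Finset.prod_congr rfl fun i _ => ?_
    rw [← hg i, ind_mapHalf]
  have hall : (Fintype.card (HalfSubspace n) : ℝ) * tupleNum (n / 2) k =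
      tupleNum n k * ∑ A : HalfSubspace n, ∏ i, ind (v i) A.1 := by
    calc (Fintype.card (HalfSubspace n) : ℝ) * tupleNum (n / 2) k
        = ∑ A : HalfSubspace n, tupleNum (n / 2) k := by simp
      _ = ∑ w : Fin k → Str n, ∑ A : HalfSubspace n,
            (if LinearIndependent (ZMod 2) w then ∏ i, ind (w i) A.1 else 0) := by
          rw [Finset.sum_comm]
          exact Finset.sum_congr rfl fun A _ => by rw [← tupleNum_finrank_eq_sum, A.2]
      _ = ∑ w : Fin k → Str n, (if LinearIndependent (ZMod 2) w then (1 : ℝ) else 0) *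
            ∑ A : HalfSubspace n, ∏ i, ind (v i) A.1 := by
          refine Finset.sum_congr rfl fun w _ => ?_
          by_cases hw : LinearIndependent (ZMod 2) w
          · simp [hw, hconst w hw]
          · simp [hw]
      _ = _ := by
          rw [← Finset.sum_mul, Finset.sum_boole, ← Fintype.card_subtype,
            ← Nat.card_eq_fintype_card]
          have h := card_independent_tuples (⊤ : Submodule (ZMod 2) (Str n)) k
          simp only [finrank_top, Module.finrank_fin_fun, Submodule.mem_top, implies_true,
            and_true] at h
          rw [h]
  rw [supNum, hall, mul_div_cancel_left₀ _ (tupleNum_pos hkn).ne']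

lemma two_pow_eq_sq {n : ℕ} (hn : Even n) : (2 : ℝ) ^ n = (2 ^ (n / 2)) ^ 2 := by
  rw [← pow_mul, Nat.div_mul_cancel hn.two_dvd]

lemma supNum_nonneg (n k : ℕ) (hk : k ≤ n / 2) : 0 ≤ supNum n k :=
  div_nonneg (mul_nonneg (Nat.cast_nonneg _) (tupleNum_pos hk).le)
    (tupleNum_pos (hk.trans (Nat.div_le_self n 2))).le

lemma eight_le {n : ℕ} (h6 : 6 ≤ n) : (8 : ℝ) ≤ 2 ^ (n / 2) := by
  calc (8 : ℝ) = 2 ^ 3 := by norm_num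
    _ ≤ 2 ^ (n / 2) := pow_le_pow_right₀ (by norm_num) (by omega)

lemma supNum_succ (n k : ℕ) : supNum n (k + 1) =
    supNum n k * ((2 ^ (n / 2) - 2 ^ k) / (2 ^ n - 2 ^ k)) := by
  simp only [supNum, tupleNum, Fin.prod_univ_castSucc, Fin.val_castSucc, Fin.val_last]
  rw [← mul_assoc, mul_div_mul_comm]

lemma supNum_one {n : ℕ} (hn : Even n) (h6 : 6 ≤ n) :
    supNum n 1 = Fintype.card (HalfSubspace n) / (2 ^ (n / 2) + 1) := by
  have hQ := eight_le h6
  have h0 : supNum n 0 = Fintype.card (HalfSubspace n) := by simp [supNum, tupleNum]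
  rw [supNum_succ, h0, two_pow_eq_sq hn]
  generalize (2 : ℝ) ^ (n / 2) = Q at *
  have : Q ^ 2 - 1 ≠ 0 := by nlinarith
  have : Q + 1 ≠ 0 := by nlinarith
  rw [pow_zero]
  field_simp
  ring

lemma supNum_two_le {n : ℕ} (hn : Even n) (h6 : 6 ≤ n) :
    supNum n 2 ≤ supNum n 1 / 2 ^ (n / 2) := by
  have hQ := eight_le h6
  have h := supNum_nonneg n 1 (by omega)
  rw [supNum_succ n 1, two_pow_eq_sq hn, div_eq_mul_one_div (supNum n 1)]
  refine mul_le_mul_of_nonneg_left ?_ h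
  generalize (2 : ℝ) ^ (n / 2) = Q at *
  rw [div_le_div_iff₀ (by nlinarith) (by linarith)]
  nlinarith

lemma supNum_three_le {n : ℕ} (hn : Even n) (h6 : 6 ≤ n) : supNum n 3 ≤ supNum n 2 := by
  have hQ := eight_le h6
  have h := supNum_nonneg n 2 (by omega)
  rw [supNum_succ n 2, two_pow_eq_sq hn]
  refine mul_le_of_le_one_right h ?_
  generalize (2 : ℝ) ^ (n / 2) = Q at *
  rw [div_le_one (by nlinarith)]
  nlinarith

lemma tupleNum_mul_supNum_le {n k : ℕ} (hn : Even n) (h6 : 6 ≤ n) (hk : k ≤ 3) :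
    tupleNum (n / 2) k * supNum n k ≤ Fintype.card (HalfSubspace n) := by
  have hQ := eight_le h6
  have hpos := tupleNum_pos (d := n) (k := k) (by omega)
  rw [supNum, ← mul_div_assoc, div_le_iff₀ hpos, mul_left_comm]
  refine mul_le_mul_of_nonneg_left ?_ (Nat.cast_nonneg _)
  rw [tupleNum, tupleNum, ← Finset.prod_mul_distrib]
  have hi : ∀ i : Fin k, (1 : ℝ) ≤ 2 ^ (i : ℕ) ∧ (2 : ℝ) ^ (i : ℕ) ≤ 4 := fun i =>
    ⟨one_le_pow₀ (by norm_num), by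
      calc (2 : ℝ) ^ (i : ℕ) ≤ 2 ^ 2 := pow_le_pow_right₀ (by norm_num) (by omega)
        _ = 4 := by norm_num⟩
  refine Finset.prod_le_prod (fun i _ => mul_self_nonneg _) fun i _ => ?_
  obtain ⟨h1, h4⟩ := hi i
  rw [two_pow_eq_sq hn]
  nlinarith

/-! ### Products of two and three membership functions -/

lemma ZMod.two_cases (a : ZMod 2) : a = 0 ∨ a = 1 := by
  revert a; decide

lemma Str.add_self {n : ℕ} (x : Str n) : x + x = 0 :=
  funext fun _ => CharTwo.add_self_eq_zero _

lemma Str.add_eq_zero {n : ℕ} {x y : Str n} : x + y = 0 ↔ x = y :=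
  ⟨fun h => by rw [← add_zero x, ← Str.add_self y, ← add_assoc, h, zero_add],
    fun h => by rw [h, Str.add_self]⟩

section
variable {n : ℕ} {x y z : Str n}

lemma sum_ind (hx : x ≠ 0) : ∑ A : HalfSubspace n, ind x A.1 = supNum n 1 := by
  have hv : LinearIndependent (ZMod 2) ![x] := by
    rw [linearIndependent_unique_iff]; simpa using hx
  simpa using sum_prod_ind hv

lemma sum_ind_mul_ind (hx : x ≠ 0) (hy : y ≠ 0) (hxy : x ≠ y) :
    ∑ A : HalfSubspace n, ind x A.1 * ind y A.1 = supNum n 2 := by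
  have hv : LinearIndependent (ZMod 2) ![x, y] := by
    rw [Fintype.linearIndependent_iff]
    intro g hg
    rw [Fin.sum_univ_two] at hg
    rcases ZMod.two_cases (g 0) with h0 | h0 <;> rcases ZMod.two_cases (g 1) with h1 | h1 <;>
      simp_all [Str.add_eq_zero, Fin.forall_fin_two]
  simpa [Fin.prod_univ_two] using sum_prod_ind hv

lemma sum_ind_mul_ind_mul_ind (hx : x ≠ 0) (hy : y ≠ 0) (hz : z ≠ 0) (hxy : x ≠ y)
    (hxz : x ≠ z) (hyz : y ≠ z) (hxyz : z ≠ y + x) :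
    ∑ A : HalfSubspace n, ind x A.1 * ind y A.1 * ind z A.1 = supNum n 3 := by
  have hv : LinearIndependent (ZMod 2) ![x, y, z] := by
    rw [Fintype.linearIndependent_iff]
    intro g hg
    rw [Fin.sum_univ_three] at hg
    have h3 : x + y ≠ z := fun h => hxyz (by rw [← h, add_comm])
    rcases ZMod.two_cases (g 0) with h0 | h0 <;> rcases ZMod.two_cases (g 1) with h1 | h1 <;>
      rcases ZMod.two_cases (g 2) with h2 | h2 <;>
      simp_all [Str.add_eq_zero, Fin.forall_fin_succ]
  simpa [Fin.prod_univ_three] using sum_prod_ind hv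
end

lemma sum_ind_mul_ind_eq {n : ℕ} {y z : Str n} (hy : y ≠ 0) (hz : z ≠ 0) :
    ∑ A : HalfSubspace n, ind y A.1 * ind z A.1 =
      supNum n 2 + (supNum n 1 - supNum n 2) * (if y = z then 1 else 0) := by
  by_cases h : y = z
  · subst h
    simp only [ind_mul_self, sum_ind hy]
    simp
  · rw [sum_ind_mul_ind hy hz h]
    simp [h]

/-- Among the pairs `(y, z)` outside `{0, x}`, only `z = y` and `z = y + x` fail to be independent
together with `x`. -/
lemma sum_ind_mul_ind_mul_ind_eq {n : ℕ} {x y z : Str n} (hx : x ≠ 0) (hy : y ≠ 0) (hz : z ≠ 0)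
    (hyx : y ≠ x) (hzx : z ≠ x) :
    ∑ A : HalfSubspace n, ind x A.1 * ind y A.1 * ind z A.1 =
      supNum n 3 + (supNum n 2 - supNum n 3) *
        ((if y = z then 1 else 0) + (if y + x = z then 1 else 0)) := by
  by_cases h : y = z
  · subst h
    simp only [mul_assoc, ind_mul_self, sum_ind_mul_ind hx hy hyx.symm]
    simp [hx]
  · by_cases h' : y + x = z
    · subst h'
      have (A : HalfSubspace n) : ind x A.1 * ind y A.1 * ind (y + x) A.1 =
          ind x A.1 * ind y A.1 := by
        rw [mul_right_comm, ind_mul_ind_add, mul_assoc, ind_mul_self]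
      simp only [this, sum_ind_mul_ind hx hy hyx.symm]
      simp [hx]
    · rw [sum_ind_mul_ind_mul_ind hx hy hz hyx.symm hzx.symm h (Ne.symm h')]
      simp [h, h']

/-! ### Gram matrices of membership functions -/

/-- The functions `A ↦ [y ∈ A]`, `y ≠ 0`, have a Gram matrix of the form `α I + β J`, and sum to a
constant. Combinations with coefficients of sum zero are orthogonal to the constants. -/
lemma sum_sq_combination {n : ℕ} (c : Str n → ℝ) (hc : ∑ y ∈ Finset.univ.erase 0, c y = 0) :
    ∑ A : HalfSubspace n, (∑ y, c y * ind y A.1) ^ 2 =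
      Fintype.card (HalfSubspace n) * c 0 ^ 2 +
        (supNum n 1 - supNum n 2) * ∑ y ∈ Finset.univ.erase 0, c y ^ 2 := by
  set s : Finset (Str n) := Finset.univ.erase 0
  have hs : ∀ y ∈ s, y ≠ 0 := fun y hy => (Finset.mem_erase.1 hy).1
  have hsplit (A : HalfSubspace n) : (∑ y, c y * ind y A.1) ^ 2 =
      c 0 ^ 2 + 2 * c 0 * (∑ y ∈ s, c y * ind y A.1) +
        ∑ y ∈ s, ∑ z ∈ s, c y * c z * (ind y A.1 * ind z A.1) := by
    rw [← Finset.add_sum_erase _ _ (Finset.mem_univ 0), ind_zero]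
    have : ∑ y ∈ s, ∑ z ∈ s, c y * c z * (ind y A.1 * ind z A.1) =
        (∑ y ∈ s, c y * ind y A.1) ^ 2 := by
      rw [sq, Finset.sum_mul_sum]
      exact Finset.sum_congr rfl fun y _ => Finset.sum_congr rfl fun z _ => by ring
    rw [this]
    ring
  have hlin : ∑ A : HalfSubspace n, ∑ y ∈ s, c y * ind y A.1 = 0 := by
    rw [Finset.sum_comm]
    simp_rw [← Finset.mul_sum]
    rw [Finset.sum_congr rfl fun y hy => by rw [sum_ind (hs y hy)], ← Finset.sum_mul, hc, zero_mul]
  have hquad : ∑ A : HalfSubspace n, ∑ y ∈ s, ∑ z ∈ s, c y * c z * (ind y A.1 * ind z A.1) =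
      (supNum n 1 - supNum n 2) * ∑ y ∈ s, c y ^ 2 := by
    calc _ = ∑ y ∈ s, ∑ z ∈ s, c y * c z * ∑ A : HalfSubspace n, ind y A.1 * ind z A.1 := by
          rw [Finset.sum_comm]
          refine Finset.sum_congr rfl fun y _ => ?_
          rw [Finset.sum_comm]
          simp_rw [Finset.mul_sum]
      _ = ∑ y ∈ s, (supNum n 2 * (c y * ∑ z ∈ s, c z) +
            (supNum n 1 - supNum n 2) * c y ^ 2) := by
          refine Finset.sum_congr rfl fun y hy => ?_
          rw [Finset.sum_congr rfl fun z hz => by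
            rw [sum_ind_mul_ind_eq (hs y hy) (hs z hz)]]
          simp only [mul_add, Finset.sum_add_distrib, Finset.mul_sum, mul_ite, mul_one, mul_zero,
            Finset.sum_ite_eq, hy, if_true]
          congr 1
          · exact Finset.sum_congr rfl fun z _ => by ring
          · ring
      _ = _ := by
          rw [hc]
          simp [Finset.mul_sum]
  simp_rw [hsplit]
  rw [Finset.sum_add_distrib, Finset.sum_add_distrib, hquad, ← Finset.mul_sum, hlin]
  simp

/-- On `y ∉ {0, x}` the Gram matrix of the products `[x ∈ A] [y ∈ A]` is a multiple of the all-ones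
matrix, which contributes little because the coefficients nearly cancel, plus multiples of the
identity and of the permutation `y ↦ y + x`. -/
lemma sum_ind_mul_sq_le {n : ℕ} (hn : Even n) (h6 : 6 ≤ n) (c : Str n → ℝ)
    (hc : ∑ y ∈ Finset.univ.erase 0, c y = 0) {x : Str n} (hx : x ≠ 0) :
    ∑ A : HalfSubspace n, (ind x A.1 * ∑ y ∈ (Finset.univ.erase 0).erase x, c y * ind y A.1) ^ 2 ≤
      2 * supNum n 2 * ∑ y ∈ Finset.univ.erase 0, c y ^ 2 := by
  set s : Finset (Str n) := (Finset.univ.erase 0).erase x with hsdef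
  have hs : ∀ y ∈ s, y ≠ x ∧ y ≠ 0 := fun y hy => by simpa [hsdef] using hy
  have hxmem : x ∈ (Finset.univ.erase 0 : Finset (Str n)) := by simpa using hx
  have hsum : ∑ y ∈ s, c y = - c x := by
    rw [← Finset.add_sum_erase _ _ hxmem] at hc
    linarith
  have hsumsq := Finset.add_sum_erase _ (fun y => c y ^ 2) hxmem
  have hadd : ∀ y ∈ s, y + x ∈ s := by
    intro y hy
    obtain ⟨h1, h2⟩ := hs y hy
    simp only [hsdef, Finset.mem_erase, Finset.mem_univ, and_true, ne_eq, Str.add_eq_zero]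
    exact ⟨by simpa using h2, h1⟩
  have hshift : ∑ y ∈ s, c (y + x) ^ 2 = ∑ y ∈ s, c y ^ 2 :=
    Finset.sum_bij' (fun y _ => y + x) (fun y _ => y + x) hadd hadd
      (fun y _ => by rw [add_assoc, Str.add_self, add_zero])
      (fun y _ => by rw [add_assoc, Str.add_self, add_zero]) (fun y _ => rfl)
  have hcross : ∑ y ∈ s, c y * c (y + x) ≤ ∑ y ∈ s, c y ^ 2 := by
    have : ∑ y ∈ s, c y * c (y + x) ≤ ∑ y ∈ s, (c y ^ 2 + c (y + x) ^ 2) / 2 :=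
      Finset.sum_le_sum fun y _ => by nlinarith [sq_nonneg (c y - c (y + x))]
    rw [← Finset.sum_div, Finset.sum_add_distrib, hshift] at this
    linarith
  have hsplit (A : HalfSubspace n) : (ind x A.1 * ∑ y ∈ s, c y * ind y A.1) ^ 2 =
      ∑ y ∈ s, ∑ z ∈ s, c y * c z * (ind x A.1 * ind y A.1 * ind z A.1) := by
    rw [mul_pow, sq (ind x A.1), ind_mul_self, sq, Finset.sum_mul_sum, Finset.mul_sum]
    refine Finset.sum_congr rfl fun y _ => ?_
    rw [Finset.mul_sum]
    exact Finset.sum_congr rfl fun z _ => by ring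
  have hquad : ∑ A : HalfSubspace n, (ind x A.1 * ∑ y ∈ s, c y * ind y A.1) ^ 2 =
      supNum n 3 * c x ^ 2 + (supNum n 2 - supNum n 3) *
        (∑ y ∈ s, c y ^ 2 + ∑ y ∈ s, c y * c (y + x)) := by
    calc _ = ∑ y ∈ s, ∑ z ∈ s, c y * c z *
            ∑ A : HalfSubspace n, ind x A.1 * ind y A.1 * ind z A.1 := by
          simp_rw [hsplit]
          rw [Finset.sum_comm]
          refine Finset.sum_congr rfl fun y _ => ?_
          rw [Finset.sum_comm]
          simp_rw [Finset.mul_sum]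
      _ = ∑ y ∈ s, (supNum n 3 * (c y * ∑ z ∈ s, c z) +
            (supNum n 2 - supNum n 3) * (c y ^ 2 + c y * c (y + x))) := by
          refine Finset.sum_congr rfl fun y hy => ?_
          rw [Finset.sum_congr rfl fun z hz => by
            rw [sum_ind_mul_ind_mul_ind_eq hx (hs y hy).2 (hs z hz).2 (hs y hy).1 (hs z hz).1]]
          simp only [mul_add, Finset.sum_add_distrib, Finset.mul_sum, mul_ite, mul_one, mul_zero,
            Finset.sum_ite_eq, hy, hadd y hy, if_true]
          rw [Finset.sum_congr rfl fun z _ => show c y * c z * supNum n 3 =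
            supNum n 3 * (c y * c z) by ring]
          ring
      _ = _ := by
          rw [Finset.sum_add_distrib, ← Finset.mul_sum, ← Finset.mul_sum, ← Finset.sum_mul, hsum,
            Finset.sum_add_distrib]
          ring
  rw [hquad, ← hsumsq]
  have h2 := supNum_nonneg n 2 (by omega)
  have h3 := supNum_nonneg n 3 (by omega)
  have h32 := supNum_three_le hn h6
  have hS : 0 ≤ ∑ y ∈ s, c y ^ 2 := Finset.sum_nonneg fun y _ => sq_nonneg _
  nlinarith [mul_le_mul_of_nonneg_left hcross (sub_nonneg.2 h32),
    mul_nonneg (sub_nonneg.2 h32) (sq_nonneg (c x)), mul_nonneg h2 (sq_nonneg (c x)),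
    mul_nonneg h3 hS]

/-- The third moment of the intersection of two half-dimensional subspaces: a cube of a power of
two is a combination of the numbers of independent tuples of length at most `3`, with the Gaussian
binomial coefficients `1, 7, 7, 1`. -/
lemma sum_card_inf_cube_le {n : ℕ} (hn : Even n) (h6 : 6 ≤ n) (A : HalfSubspace n) :
    ∑ B : HalfSubspace n, (∑ y, ind y A.1 * ind y B.1) ^ 3 ≤
      16 * Fintype.card (HalfSubspace n) := by
  classical
  have hcube (d : ℕ) : ((2 : ℝ) ^ d) ^ 3 =
      tupleNum d 0 + 7 * tupleNum d 1 + 7 * tupleNum d 2 + tupleNum d 3 := by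
    simp only [tupleNum, Fin.prod_univ_zero, Fin.prod_univ_one, Fin.prod_univ_two,
      Fin.prod_univ_three, Fin.isValue, Fin.val_zero, Fin.val_one, Fin.val_two]
    ring
  have hk (k : ℕ) (hk3 : k ≤ 3) :
      ∑ B : HalfSubspace n, tupleNum (Module.finrank (ZMod 2) (A.1 ⊓ B.1 :)) k ≤
        Fintype.card (HalfSubspace n) := by
    refine le_of_eq_of_le ?_ (tupleNum_mul_supNum_le hn h6 hk3)
    simp_rw [tupleNum_finrank_eq_sum, ind_inf, Finset.prod_mul_distrib]
    have hA := tupleNum_finrank_eq_sum A.1 k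
    rw [A.2] at hA
    rw [Finset.sum_comm, hA, Finset.sum_mul]
    refine Finset.sum_congr rfl fun v _ => ?_
    by_cases hv : LinearIndependent (ZMod 2) v
    · simp only [hv, if_true, ← Finset.mul_sum, sum_prod_ind hv]
    · simp [hv]
  have (B : HalfSubspace n) : (∑ y, ind y A.1 * ind y B.1) ^ 3 =
      ((2 : ℝ) ^ Module.finrank (ZMod 2) (A.1 ⊓ B.1 :)) ^ 3 := by
    simp_rw [← ind_inf, sum_ind_eq_card]
  simp_rw [this, hcube, Finset.sum_add_distrib, ← Finset.mul_sum]
  linarith [hk 0 (by norm_num), hk 1 (by norm_num), hk 2 (by norm_num), hk 3 (by norm_num)]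

/-! ### The span of the membership functions -/

/-- The space of complex functions of the hidden subspace spanned by the membership functions
`A ↦ [y ∈ A]`. It contains the constants (`y = 0`) and the amplitudes of `|A⟩`. -/
noncomputable def memberSpan (n : ℕ) : Submodule ℂ (HalfSubspace n → ℂ) :=
  Submodule.span ℂ (Set.range fun (y : Str n) (A : HalfSubspace n) => (ind y A.1 : ℂ))

lemma ind_mem_memberSpan {n : ℕ} (y : Str n) :
    (fun A : HalfSubspace n => (ind y A.1 : ℂ)) ∈ memberSpan n :=
  Submodule.subset_span ⟨y, rfl⟩

/-- The coefficients can be normalized because `∑ y, [y ∈ A]` does not depend on `A`. -/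
lemma exists_coeff {n : ℕ} (hn : 1 ≤ n) {f : HalfSubspace n → ℂ} (hf : f ∈ memberSpan n) :
    ∃ c : Str n → ℂ, ∑ y ∈ Finset.univ.erase 0, c y = 0 ∧
      ∀ A, f A = ∑ y, c y * (ind y A.1 : ℂ) := by
  obtain ⟨c, rfl⟩ := (Submodule.mem_span_range_iff_exists_fun ℂ).1 hf
  set q : ℂ := 2 ^ (n / 2)
  -- The mean `m` of the coefficients of the nonzero strings is moved to the constant `[0 ∈ A]`.
  set m : ℂ := (∑ y ∈ Finset.univ.erase 0, c y) / (2 ^ n - 1)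
  have hn1 : ((2 : ℂ) ^ n - 1) ≠ 0 := by
    have : (1 : ℝ) < 2 ^ n := one_lt_pow₀ (by norm_num) (by omega)
    exact_mod_cast (sub_pos.2 this).ne'
  refine ⟨fun y => c y - m + (if y = 0 then m * q else 0), ?_, fun A => ?_⟩
  · rw [Finset.sum_congr rfl fun y hy =>
        show c y - m + (if y = 0 then m * q else 0) = c y - m by
          rw [if_neg (Finset.mem_erase.1 hy).1, add_zero],
      Finset.sum_sub_distrib, Finset.sum_const, Finset.card_erase_of_mem (Finset.mem_univ _),
      Finset.card_univ]
    have hcard : ((Fintype.card (Str n) - 1 : ℕ) : ℂ) = 2 ^ n - 1 := by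
      have : Fintype.card (Str n) = 2 ^ n := by simp [Str, ZMod.card]
      rw [this, Nat.cast_sub Nat.one_le_two_pow]
      push_cast
      ring
    rw [nsmul_eq_mul, hcard, mul_div_cancel₀ _ hn1, sub_self]
  · have hsum : ∑ y, (ind y A.1 : ℂ) = q := by
      have := sum_ind_eq_card A.1
      rw [A.2] at this
      rw [← Complex.ofReal_sum, this]
      push_cast
      rfl
    have : ∑ y, (c y - m + (if y = 0 then m * q else 0)) * (ind y A.1 : ℂ) =
        ∑ y, c y * (ind y A.1 : ℂ) - m * ∑ y, (ind y A.1 : ℂ) + m * q := by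
      simp only [add_mul, sub_mul, Finset.sum_add_distrib, Finset.sum_sub_distrib, ite_mul,
        zero_mul, Finset.sum_ite_eq', Finset.mem_univ, if_true, ind_zero, Finset.mul_sum]
      simp
    rw [this, hsum]
    simp [Finset.sum_apply, smul_eq_mul]

lemma sq_norm_eq (z : ℂ) : ‖z‖ ^ 2 = z.re ^ 2 + z.im ^ 2 := by
  rw [Complex.sq_norm, Complex.normSq_apply]; ring

lemma sum_sq_norm_combination {n : ℕ} (c : Str n → ℂ) (hc : ∑ y ∈ Finset.univ.erase 0, c y = 0) :
    ∑ A : HalfSubspace n, ‖∑ y, c y * (ind y A.1 : ℂ)‖ ^ 2 =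
      Fintype.card (HalfSubspace n) * ‖c 0‖ ^ 2 +
        (supNum n 1 - supNum n 2) * ∑ y ∈ Finset.univ.erase 0, ‖c y‖ ^ 2 := by
  have hre := sum_sq_combination (fun y => (c y).re) (by rw [← Complex.re_sum, hc]; rfl)
  have him := sum_sq_combination (fun y => (c y).im) (by rw [← Complex.im_sum, hc]; rfl)
  simp only [sq_norm_eq, Complex.re_sum, Complex.im_sum, Complex.re_mul_ofReal,
    Complex.im_mul_ofReal, Finset.sum_add_distrib, hre, him]
  ring

lemma sum_sq_norm_ind_mul_le {n : ℕ} (hn : Even n) (h6 : 6 ≤ n) (c : Str n → ℂ)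
    (hc : ∑ y ∈ Finset.univ.erase 0, c y = 0) {x : Str n} (hx : x ≠ 0) :
    ∑ A : HalfSubspace n, ‖(ind x A.1 : ℂ) *
        ∑ y ∈ (Finset.univ.erase 0).erase x, c y * (ind y A.1 : ℂ)‖ ^ 2 ≤
      2 * supNum n 2 * ∑ y ∈ Finset.univ.erase 0, ‖c y‖ ^ 2 := by
  have hre := sum_ind_mul_sq_le hn h6 (fun y => (c y).re) (by rw [← Complex.re_sum, hc]; rfl) hx
  have him := sum_ind_mul_sq_le hn h6 (fun y => (c y).im) (by rw [← Complex.im_sum, hc]; rfl) hx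
  simp only [sq_norm_eq, Complex.re_sum, Complex.im_sum, Complex.re_ofReal_mul,
    Complex.im_ofReal_mul, Complex.re_mul_ofReal,
    Complex.im_mul_ofReal, Finset.sum_add_distrib]
  linarith

lemma supNum_two_mul_le {n : ℕ} (hn : Even n) (h6 : 6 ≤ n) :
    8 * supNum n 2 ≤ 16 / 2 ^ (n / 2) * (supNum n 1 - supNum n 2) := by
  have hQ := eight_le h6
  have h2 := supNum_two_le hn h6
  have h0 := supNum_nonneg n 2 (by omega)
  rw [le_div_iff₀ (by linarith)] at h2
  rw [div_mul_eq_mul_div, le_div_iff₀ (by linarith)]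
  nlinarith

/-- Multiplication by the sign `(-1)^[x ∈ A]` nearly preserves the span: the products
`[x ∈ A] [y ∈ A]` with `x`, `y` independent are much shorter than `[y ∈ A]`. -/
lemma exists_near_sign_mul {n : ℕ} (hn : Even n) (h6 : 6 ≤ n) {f : HalfSubspace n → ℂ}
    (hf : f ∈ memberSpan n) (x : Str n) :
    ∃ g ∈ memberSpan n, ∑ A : HalfSubspace n, ‖(1 - 2 * (ind x A.1 : ℂ)) * f A - g A‖ ^ 2 ≤
      16 / 2 ^ (n / 2) * ∑ A, ‖f A‖ ^ 2 := by
  have hQ := eight_le h6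
  by_cases hx : x = 0
  · refine ⟨-f, neg_mem hf, ?_⟩
    subst hx
    have : ∀ A : HalfSubspace n, (1 - 2 * (ind 0 A.1 : ℂ)) * f A - (-f) A = 0 := fun A => by
      rw [ind_zero, Pi.neg_apply]; push_cast; ring
    simp only [this, norm_zero]
    simp only [ne_eq, OfNat.ofNat_ne_zero, not_false_eq_true, zero_pow, Finset.sum_const_zero]
    positivity
  obtain ⟨c, hc, hfc⟩ := exists_coeff (by omega) hf
  have hxmem : x ∈ (Finset.univ.erase 0 : Finset (Str n)) := by simpa using hx
  -- The terms `y = 0` and `y = x` of `[x ∈ A] f A` add up to a multiple of `[x ∈ A]`.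
  refine ⟨f - (2 * (c 0 + c x)) • fun A => (ind x A.1 : ℂ),
    sub_mem hf (Submodule.smul_mem _ _ (ind_mem_memberSpan x)), ?_⟩
  have hdiff (A : HalfSubspace n) : (1 - 2 * (ind x A.1 : ℂ)) * f A -
      (f - (2 * (c 0 + c x)) • fun A : HalfSubspace n => (ind x A.1 : ℂ)) A =
      (-2) * ((ind x A.1 : ℂ) *
        ∑ y ∈ (Finset.univ.erase 0).erase x, c y * (ind y A.1 : ℂ)) := by
    have hxx : (ind x A.1 : ℂ) * (ind x A.1 : ℂ) = ind x A.1 := by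
      exact_mod_cast congrArg (fun r : ℝ => (r : ℂ)) (ind_mul_self x A.1)
    rw [Pi.sub_apply, Pi.smul_apply, hfc, ← Finset.add_sum_erase _ _ (Finset.mem_univ 0),
      ← Finset.add_sum_erase _ _ hxmem, ind_zero, smul_eq_mul, Complex.ofReal_one]
    linear_combination (-2 * c x) * hxx
  have h2 := sum_sq_norm_ind_mul_le hn h6 c hc hx
  have h1 := sum_sq_norm_combination c hc
  simp_rw [← hfc] at h1
  have hS : 0 ≤ ∑ y ∈ Finset.univ.erase 0, ‖c y‖ ^ 2 := Finset.sum_nonneg fun y _ => sq_nonneg _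
  simp_rw [hdiff, norm_mul (-2 : ℂ), mul_pow, ← Finset.mul_sum]
  calc ‖(-2 : ℂ)‖ ^ 2 * _ ≤ 4 * (2 * supNum n 2 * ∑ y ∈ Finset.univ.erase 0, ‖c y‖ ^ 2) := by
        gcongr
        norm_num
    _ = 8 * supNum n 2 * ∑ y ∈ Finset.univ.erase 0, ‖c y‖ ^ 2 := by ring
    _ ≤ 16 / 2 ^ (n / 2) * (supNum n 1 - supNum n 2) * ∑ y ∈ Finset.univ.erase 0, ‖c y‖ ^ 2 :=
        mul_le_mul_of_nonneg_right (supNum_two_mul_le hn h6) hS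
    _ ≤ _ := by
        rw [h1, mul_assoc]
        refine mul_le_mul_of_nonneg_left ?_ (by positivity)
        exact le_add_of_nonneg_left (by positivity)

/-! ### Duality -/

lemma finrank_perp {n : ℕ} (A : Submodule (ZMod 2) (Str n)) :
    Module.finrank (ZMod 2) (perp A) = n - Module.finrank (ZMod 2) A ∧ perp (perp A) = A := by
  let B : LinearMap.BilinForm (ZMod 2) (Str n) := dotProductBilin (ZMod 2) (ZMod 2)
  have hB : B = (1 : Matrix (Fin n) (Fin n) (ZMod 2)).toBilin' := by
    ext
    simp [B, Matrix.one_apply, Pi.single_apply, eq_comm]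
  have hnd : B.Nondegenerate := 
    hB ▸ LinearMap.BilinForm.nondegenerate_toBilin'_of_det_ne_zero' _ (by simp)
  have hsymm : B.IsRefl := fun x y h => by
    simpa [B, dotProduct_comm] using h
  have hperp (S : Submodule (ZMod 2) (Str n)) : perp S = B.orthogonal S := by
    ext y
    rfl
  rw [hperp, hperp, LinearMap.BilinForm.finrank_orthogonal hnd,
    LinearMap.BilinForm.orthogonal_orthogonal hnd hsymm]
  simp

/-- For even `n`, the map `A ↦ A^⊥` is an involution of the subspaces of dimension `n / 2`. -/
def perpHalf {n : ℕ} (hn : Even n) : HalfSubspace n ≃ HalfSubspace n :=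
  Function.Involutive.toPerm
    (fun A => ⟨perp A.1, by rw [(finrank_perp A.1).1, A.2]; obtain ⟨k, rfl⟩ := hn; omega⟩)
    (fun A => Subtype.ext (finrank_perp A.1).2)

lemma perpHalf_perpHalf {n : ℕ} (hn : Even n) (A : HalfSubspace n) :
    perpHalf hn (perpHalf hn A) = A :=
  Subtype.ext (finrank_perp A.1).2

/-- A linear functional that is nonzero on `S` vanishes on exactly half of `S`. -/
lemma sum_ind_filter_dotProduct {n : ℕ} (S : Submodule (ZMod 2) (Str n)) (x : Str n) :
    2 * ∑ y with y ⬝ᵥ x = 0, ind y S = (∑ y, ind y S) * (ind x (perp S) + 1) := by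
  by_cases hx : x ∈ perp S
  · have : ∑ y with y ⬝ᵥ x = 0, ind y S = ∑ y, ind y S := by
      rw [Finset.sum_filter]
      refine Finset.sum_congr rfl fun y _ => ?_
      by_cases hy : y ∈ S
      · rw [if_pos (hx y hy)]
      · simp [ind, hy]
    rw [this, show ind x (perp S) = 1 by simp [ind, hx]]
    ring
  · obtain ⟨z, hz, hzx⟩ : ∃ z ∈ S, z ⬝ᵥ x ≠ 0 := by
      by_contra! h
      exact hx h
    have hzx1 : z ⬝ᵥ x = 1 := (ZMod.two_cases _).resolve_left hzx
    have hswap : ∑ y with y ⬝ᵥ x = 0, ind y S = ∑ y with ¬ y ⬝ᵥ x = 0, ind y S := by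
      refine Finset.sum_bij' (fun y _ => y + z) (fun y _ => y + z) ?_ ?_ ?_ ?_ ?_
      · intro y hy
        simp only [Finset.mem_filter, Finset.mem_univ, true_and] at hy ⊢
        rw [add_dotProduct, hy, hzx1]
        decide
      · intro y hy
        simp only [Finset.mem_filter, Finset.mem_univ, true_and] at hy ⊢
        rw [add_dotProduct, (ZMod.two_cases _).resolve_left hy, hzx1]
        decide
      · intro y _
        simp only [add_assoc, Str.add_self, add_zero]
      · intro y _
        simp only [add_assoc, Str.add_self, add_zero]
      · intro y _
        exact (ind_congr (S.add_mem_iff_left hz)).symm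
    have htot := Finset.sum_filter_add_sum_filter_not Finset.univ
      (fun y : Str n => y ⬝ᵥ x = 0) (fun y => ind y S)
    rw [show ind x (perp S) = 0 by simp [ind, hx]]
    linarith

lemma ind_perp_mem_memberSpan {n : ℕ} (x : Str n) :
    (fun A : HalfSubspace n => (ind x (perp A.1) : ℂ)) ∈ memberSpan n := by
  have h : (fun A : HalfSubspace n => (ind x (perp A.1) : ℂ)) =
      (2 / 2 ^ (n / 2) : ℂ) • (∑ y with y ⬝ᵥ x = 0, fun A : HalfSubspace n => (ind y A.1 : ℂ)) -
        fun A : HalfSubspace n => (ind 0 A.1 : ℂ) := by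
    funext A
    have h2 := sum_ind_filter_dotProduct A.1 x
    rw [sum_ind_eq_card, A.2] at h2
    have h3 : (2 : ℂ) * ∑ y with y ⬝ᵥ x = 0, (ind y A.1 : ℂ) =
        2 ^ (n / 2) * ((ind x (perp A.1) : ℂ) + 1) := by
      exact_mod_cast congrArg (fun r : ℝ => (r : ℂ)) h2
    have hq : (2 : ℂ) ^ (n / 2) ≠ 0 := pow_ne_zero _ two_ne_zero
    rw [Pi.sub_apply, Pi.smul_apply, Finset.sum_apply, smul_eq_mul, div_mul_eq_mul_div, h3,
      ind_zero, mul_div_cancel_left₀ _ hq]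
    simp
  rw [h]
  exact sub_mem (Submodule.smul_mem _ _ (sum_mem fun y _ => ind_mem_memberSpan y))
    (ind_mem_memberSpan 0)

lemma comp_perpHalf_mem_memberSpan {n : ℕ} (hn : Even n) {f : HalfSubspace n → ℂ}
    (hf : f ∈ memberSpan n) : f ∘ perpHalf hn ∈ memberSpan n := by
  have hle : memberSpan n ≤
      (memberSpan n).comap (LinearMap.funLeft ℂ ℂ (perpHalf hn)) := by
    refine Submodule.span_le.2 ?_
    rintro _ ⟨y, rfl⟩
    exact ind_perp_mem_memberSpan y
  exact hle hf

open Classical in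
/-- One query moves a state of `memberSpan` only slightly out of `memberSpan`. Queries to `A^⊥`
reduce to queries to `A` because `A ↦ A^⊥` preserves `memberSpan`. -/
lemma exists_near_oracle {n : ℕ} (hn : Even n) (h6 : 6 ≤ n) {f : HalfSubspace n → ℂ}
    (hf : f ∈ memberSpan n) (p : ZMod 2 × Str n) :
    ∃ g ∈ memberSpan n, ∑ A : HalfSubspace n,
      ‖(if p ∈ starSet A.1 then -1 else 1) * f A - g A‖ ^ 2 ≤
        16 / 2 ^ (n / 2) * ∑ A, ‖f A‖ ^ 2 := by
  obtain ⟨b, x⟩ := p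
  have hsign (P : Prop) (S : Submodule (ZMod 2) (Str n)) (h : P ↔ x ∈ S) :
      (if P then -1 else 1 : ℂ) = 1 - 2 * (ind x S : ℂ) := by
    by_cases hP : P
    · simp only [hP, if_true, ind, h.1 hP]
      norm_num
    · simp [hP, ind, mt h.2 hP]
  rcases ZMod.two_cases b with rfl | rfl
  · obtain ⟨g, hg, hle⟩ := exists_near_sign_mul hn h6 hf x
    refine ⟨g, hg, le_of_eq_of_le (Finset.sum_congr rfl fun A _ => ?_) hle⟩
    rw [hsign _ A.1 (by simp [starSet])]
  · obtain ⟨g, hg, hle⟩ := exists_near_sign_mul hn h6 (comp_perpHalf_mem_memberSpan hn hf) x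
    refine ⟨g ∘ perpHalf hn, comp_perpHalf_mem_memberSpan hn hg, ?_⟩
    rw [← Equiv.sum_comp (perpHalf hn)] at hle
    simp only [Function.comp_apply, perpHalf_perpHalf] at hle
    rw [Equiv.sum_comp (perpHalf hn) (fun A => ‖f A‖ ^ 2)] at hle
    refine le_of_eq_of_le (Finset.sum_congr rfl fun A _ => ?_) hle
    rw [hsign _ (perp A.1) (by simp [starSet])]
    rfl

/-! ### Acceptance of states in the span -/

lemma ket_eq {n : ℕ} (A : HalfSubspace n) (x : Str n) :
    ket A.1 x = (((Real.sqrt (2 ^ (n / 2)))⁻¹ * ind x A.1 : ℝ) : ℂ) := by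
  have hcard : (Nat.card A.1 : ℝ) = 2 ^ (n / 2) := by
    have h := Module.natCard_eq_pow_finrank (K := ZMod 2) (V := A.1)
    rw [A.2, Nat.card_zmod] at h
    exact_mod_cast h
  by_cases hx : x ∈ A.1
  · simp [ket, hx, ind, hcard]
  · simp [ket, hx, ind]

lemma ketTwo_eq {n : ℕ} (A : HalfSubspace n) (p : Str n × Str n) :
    ketTwo A.1 p = (((2 ^ (n / 2))⁻¹ * (ind p.1 A.1 * ind p.2 A.1) : ℝ) : ℂ) := by
  have h : (Real.sqrt (2 ^ (n / 2)))⁻¹ * (Real.sqrt (2 ^ (n / 2)))⁻¹ = ((2 : ℝ) ^ (n / 2))⁻¹ := by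
    rw [← mul_inv, Real.mul_self_sqrt (by positivity)]
  rw [ketTwo, ket_eq, ket_eq, ← Complex.ofReal_mul, ← h]
  congr 1
  ring

lemma sum_sq_norm_ket {n : ℕ} (A : HalfSubspace n) : ∑ x, ‖ket A.1 x‖ ^ 2 = 1 := by
  have h (x : Str n) : ‖ket A.1 x‖ ^ 2 = (2 ^ (n / 2))⁻¹ * ind x A.1 := by
    rw [ket_eq, Complex.norm_real, Real.norm_eq_abs, sq_abs, mul_pow, inv_pow,
      Real.sq_sqrt (by positivity), sq, ind_mul_self]
  simp_rw [h, ← Finset.mul_sum, sum_ind_eq_card, A.2]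
  exact inv_mul_cancel₀ (by positivity)

lemma sum_sq_norm_ketTwo {n : ℕ} (A : HalfSubspace n) : ∑ p, ‖ketTwo A.1 p‖ ^ 2 = 1 := by
  simp_rw [ketTwo, norm_mul, mul_pow, Fintype.sum_prod_type, ← Finset.mul_sum, sum_sq_norm_ket,
    mul_one]
  exact sum_sq_norm_ket A

/-- Schur's test for a `0`-`1` matrix `M`, with the column sums of `M` as weights: the row sums of
`M Mᵀ` bound the squared operator norm. -/
lemma sum_sq_norm_le_of_row_sum {α τ : Type*} [Fintype α] [Fintype τ] (M : τ → α → ℝ)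
    (hM0 : ∀ t a, 0 ≤ M t a) (hM : ∀ t a, M t a * M t a = M t a) {K : ℝ} (hK0 : 0 ≤ K)
    (hK : ∀ a, ∑ t, M t a * ∑ b, M t b ≤ K) (c : τ → ℂ) :
    ∑ a, ‖∑ t, c t * (M t a : ℂ)‖ ^ 2 ≤ K * ∑ t, ‖c t‖ ^ 2 := by
  set w : τ → ℝ := fun t => ∑ b, M t b
  have hw0 (t : τ) : 0 ≤ w t := Finset.sum_nonneg fun b _ => hM0 t b
  have hrow (a : α) : ‖∑ t, c t * (M t a : ℂ)‖ ^ 2 ≤ K * ∑ t, M t a * (‖c t‖ ^ 2 / w t) := by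
    have hnn : 0 ≤ ∑ t, M t a * (‖c t‖ ^ 2 / w t) :=
      Finset.sum_nonneg fun t _ => mul_nonneg (hM0 t a) (div_nonneg (sq_nonneg _) (hw0 t))
    refine le_trans ?_ (mul_le_mul_of_nonneg_right (hK a) hnn)
    refine le_trans (pow_le_pow_left₀ (norm_nonneg _) (norm_sum_le _ _) 2) ?_
    refine Finset.sum_sq_le_sum_mul_sum_of_sq_le_mul _ (fun t _ => mul_nonneg (hM0 t a) (hw0 t))
      (fun t _ => mul_nonneg (hM0 t a) (div_nonneg (sq_nonneg _) (hw0 t))) fun t _ => ?_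
    rw [norm_mul, Complex.norm_real, Real.norm_of_nonneg (hM0 t a), mul_pow, sq (M t a), hM]
    by_cases h : w t = 0
    · have : M t a = 0 :=
        (Finset.sum_eq_zero_iff_of_nonneg fun b _ => hM0 t b).1 h a (Finset.mem_univ a)
      simp [this]
    · have h2 := hM t a
      refine le_of_eq ?_
      field_simp
      rw [sq (M t a), h2]
  calc _ ≤ ∑ a, K * ∑ t, M t a * (‖c t‖ ^ 2 / w t) := Finset.sum_le_sum fun a _ => hrow a
    _ = K * ∑ t, w t * (‖c t‖ ^ 2 / w t) := by
        rw [← Finset.mul_sum, Finset.sum_comm]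
        simp_rw [← Finset.sum_mul]
        rfl
    _ ≤ _ := by
        refine mul_le_mul_of_nonneg_left (Finset.sum_le_sum fun t _ => ?_) hK0
        by_cases h : w t = 0
        · simp [h]
        · rw [mul_div_cancel₀ _ h]

lemma sum_sq_norm_triple_le {n : ℕ} (hn : Even n) (h6 : 6 ≤ n)
    (c : (Str n × Str n) × Str n → ℂ) :
    ∑ A : HalfSubspace n,
        ‖∑ t, c t * ((ind t.1.1 A.1 * ind t.1.2 A.1 * ind t.2 A.1 : ℝ) : ℂ)‖ ^ 2 ≤
      16 * Fintype.card (HalfSubspace n) * ∑ t, ‖c t‖ ^ 2 := by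
  refine sum_sq_norm_le_of_row_sum
    (fun (t : (Str n × Str n) × Str n) (A : HalfSubspace n) =>
      ind t.1.1 A.1 * ind t.1.2 A.1 * ind t.2 A.1)
    (fun t A => mul_nonneg (mul_nonneg (ind_nonneg _ _) (ind_nonneg _ _)) (ind_nonneg _ _))
    (fun t A => ?_) (by positivity) (fun A => ?_) c
  · rw [mul_mul_mul_comm, mul_mul_mul_comm (ind t.1.1 A.1), ind_mul_self, ind_mul_self,
      ind_mul_self]
  · refine le_of_eq_of_le ?_ (sum_card_inf_cube_le hn h6 A)
    simp_rw [Finset.mul_sum]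
    rw [Finset.sum_comm]
    refine Finset.sum_congr rfl fun B _ => ?_
    rw [pow_three', Finset.sum_mul_sum, ← Fintype.sum_prod_type', Finset.sum_mul_sum,
      ← Fintype.sum_prod_type']
    exact Finset.sum_congr rfl fun t _ => by ring

lemma sum_sq_norm_coeff_le {n : ℕ} (hn : Even n) (h6 : 6 ≤ n) (c : Str n → ℂ)
    (hc : ∑ y ∈ Finset.univ.erase 0, c y = 0) :
    Fintype.card (HalfSubspace n) / (2 * 2 ^ (n / 2)) * ∑ y, ‖c y‖ ^ 2 ≤
      ∑ A : HalfSubspace n, ‖∑ y, c y * (ind y A.1 : ℂ)‖ ^ 2 := by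
  have hQ := eight_le h6
  have h1 := supNum_one hn h6
  have h2 := supNum_two_le hn h6
  have hN : (0 : ℝ) ≤ Fintype.card (HalfSubspace n) := Nat.cast_nonneg _
  have hμ : (Fintype.card (HalfSubspace n) : ℝ) / (2 * 2 ^ (n / 2)) ≤
      supNum n 1 - supNum n 2 := by
    rw [h1] at h2 ⊢
    generalize (2 : ℝ) ^ (n / 2) = Q at *
    generalize (Fintype.card (HalfSubspace n) : ℝ) = N at *
    have h3 : N / (2 * Q) ≤ N / (Q + 1) - N / (Q + 1) / Q := by
      have h : N / (Q + 1) - N / (Q + 1) / Q = N * (Q - 1) / ((Q + 1) * Q) := by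
        field_simp
      rw [h, div_le_div_iff₀ (by positivity) (by positivity)]
      have : 0 ≤ N * Q * (Q - 3) := mul_nonneg (by positivity) (by linarith)
      linarith
    linarith
  rw [sum_sq_norm_combination c hc, ← Finset.add_sum_erase _ _ (Finset.mem_univ 0), mul_add]
  refine add_le_add (mul_le_mul_of_nonneg_right ?_ (sq_nonneg _))
    (mul_le_mul_of_nonneg_right hμ (Finset.sum_nonneg fun y _ => sq_nonneg _))
  exact div_le_self hN (by linarith)

/-- A state in the span is accepted with small probability: it amounts to at most one random
element of `A`, while `|A⟩ ⊗ |A⟩` requires two independent ones. -/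
lemma sum_sq_norm_accept_le {n : ℕ} (hn : Even n) (h6 : 6 ≤ n)
    (f : Str n × Str n → HalfSubspace n → ℂ) (hf : ∀ p, f p ∈ memberSpan n) :
    ∑ A : HalfSubspace n, ‖∑ p, ketTwo A.1 p * f p A‖ ^ 2 ≤
      32 / 2 ^ (n / 2) * ∑ p, ∑ A, ‖f p A‖ ^ 2 := by
  have hQ := eight_le h6
  choose c hc hfc using fun p => exists_coeff (by omega) (hf p)
  have hamp (A : HalfSubspace n) : ‖∑ p, ketTwo A.1 p * f p A‖ ^ 2 =
      ((2 ^ (n / 2))⁻¹) ^ 2 * ‖∑ t : (Str n × Str n) × Str n,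
        c t.1 t.2 * ((ind t.1.1 A.1 * ind t.1.2 A.1 * ind t.2 A.1 : ℝ) : ℂ)‖ ^ 2 := by
    have : ∑ p, ketTwo A.1 p * f p A = (((2 ^ (n / 2))⁻¹ : ℝ) : ℂ) *
        ∑ t : (Str n × Str n) × Str n,
          c t.1 t.2 * ((ind t.1.1 A.1 * ind t.1.2 A.1 * ind t.2 A.1 : ℝ) : ℂ) := by
      conv_rhs => rw [Fintype.sum_prod_type, Finset.mul_sum]
      refine Finset.sum_congr rfl fun p _ => ?_
      rw [hfc, ketTwo_eq, Finset.mul_sum, Finset.mul_sum]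
      refine Finset.sum_congr rfl fun y _ => ?_
      push_cast
      ring
    rw [this, norm_mul, mul_pow, Complex.norm_real, Real.norm_eq_abs, sq_abs]
  have hcoeff (p : Str n × Str n) := sum_sq_norm_coeff_le hn h6 (c p) (hc p)
  simp_rw [← hfc] at hcoeff
  simp_rw [hamp, ← Finset.mul_sum]
  calc _ ≤ ((2 ^ (n / 2))⁻¹) ^ 2 * (16 * Fintype.card (HalfSubspace n) *
        ∑ t : (Str n × Str n) × Str n, ‖c t.1 t.2‖ ^ 2) :=
        mul_le_mul_of_nonneg_left (sum_sq_norm_triple_le hn h6 _) (sq_nonneg _)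
    _ = 32 / 2 ^ (n / 2) * ∑ p, (Fintype.card (HalfSubspace n) / (2 * 2 ^ (n / 2)) *
          ∑ y, ‖c p y‖ ^ 2) := by
        rw [Fintype.sum_prod_type, ← Finset.mul_sum]
        field_simp
        ring
    _ ≤ _ := by
        exact mul_le_mul_of_nonneg_left (Finset.sum_le_sum fun p _ => hcoeff p) (by positivity)

/-! ### Evolution of the joint state -/

/-- A state which stays near a subspace `K` under each step, up to a relative error `η`, leaves `K`
at most linearly fast. Orthogonal projection to `K` keeps the approximations bounded. -/
lemma exists_near_iterate {E : Type*} [NormedAddCommGroup E] [InnerProductSpace ℂ E]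
    [FiniteDimensional ℂ E] (K : Submodule ℂ E) {η : ℝ} (hη : 0 ≤ η) (S : ℕ → E →ₗᵢ[ℂ] E)
    (hS : ∀ t, ∀ Φ ∈ K, ∃ Φ' ∈ K, ‖S t Φ - Φ'‖ ≤ η * ‖Φ‖) (Ψ : ℕ → E) (h0 : Ψ 0 ∈ K)
    (hstep : ∀ t, Ψ (t + 1) = S t (Ψ t)) (t : ℕ) :
    ∃ Φ ∈ K, ‖Φ‖ ≤ ‖Ψ 0‖ ∧ ‖Ψ t - Φ‖ ≤ t * η * ‖Ψ 0‖ := by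
  have hnorm : ∀ t, ‖Ψ t‖ = ‖Ψ 0‖ := fun t => by
    induction t with
    | zero => rfl
    | succ t ih => rw [hstep, LinearIsometry.norm_map, ih]
  induction t with
  | zero => exact ⟨Ψ 0, h0, le_rfl, by simp⟩
  | succ t ih =>
    obtain ⟨Φ, hΦ, hle, hdist⟩ := ih
    obtain ⟨Φ', hΦ', hdist'⟩ := hS t Φ hΦ
    refine ⟨K.starProjection (Ψ (t + 1)), K.starProjection_apply_mem _, ?_, ?_⟩
    · exact (K.norm_starProjection_apply_le _).trans (hnorm _).le
    · have hmin : ‖Ψ (t + 1) - K.starProjection (Ψ (t + 1))‖ ≤ ‖Ψ (t + 1) - Φ'‖ := by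
        rw [Submodule.starProjection_minimal]
        exact ciInf_le ⟨0, by rintro _ ⟨x, rfl⟩; exact norm_nonneg _⟩ (⟨Φ', hΦ'⟩ : K)
      refine hmin.trans ?_
      calc ‖Ψ (t + 1) - Φ'‖ = ‖S t (Ψ t - Φ) + (S t Φ - Φ')‖ := by
            rw [hstep, map_sub]; congr 1; abel
        _ ≤ ‖Ψ t - Φ‖ + η * ‖Φ‖ := by
            refine (norm_add_le _ _).trans ?_
            rw [LinearIsometry.norm_map]
            exact add_le_add_right hdist' _
        _ ≤ t * η * ‖Ψ 0‖ + η * ‖Ψ 0‖ := by gcongr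
        _ = _ := by push_cast; ring

section Joint

variable {n : ℕ} {ι : Type} [Fintype ι]

/-- The space of joint states of a register holding the hidden subspace `A` and of a memory with
basis `ι`. -/
abbrev Joint (n : ℕ) (ι : Type) [Fintype ι] : Type := EuclideanSpace ℂ (HalfSubspace n × ι)

lemma Joint.norm_sq_eq (Ψ : Joint n ι) : ‖Ψ‖ ^ 2 = ∑ A, ∑ m, ‖Ψ (A, m)‖ ^ 2 := by
  rw [EuclideanSpace.norm_sq_eq, Fintype.sum_prod_type]

variable [DecidableEq ι]

lemma sum_sq_norm_mulVec (U : Matrix.unitaryGroup ι ℂ) (v : ι → ℂ) :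
    ∑ m, ‖(U : Matrix ι ι ℂ).mulVec v m‖ ^ 2 = ∑ m, ‖v m‖ ^ 2 := by
  have h (w : ι → ℂ) : ((∑ m, ‖w m‖ ^ 2 : ℝ) : ℂ) = star w ⬝ᵥ w := by
    rw [dotProduct]
    push_cast
    exact Finset.sum_congr rfl fun m _ => (Complex.conj_mul' (w m)).symm
  have hU : (U : Matrix ι ι ℂ).conjTranspose * (U : Matrix ι ι ℂ) = 1 :=
    Matrix.mem_unitaryGroup_iff'.1 U.2
  have : star ((U : Matrix ι ι ℂ).mulVec v) ⬝ᵥ (U : Matrix ι ι ℂ).mulVec v = star v ⬝ᵥ v := by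
    rw [Matrix.star_mulVec, Matrix.dotProduct_mulVec, Matrix.vecMul_vecMul, hU, Matrix.vecMul_one]
  rw [← h, ← h] at this
  exact_mod_cast this

/-- The unitary `U A`, controlled by the register holding `A`. -/
noncomputable def controlled (U : HalfSubspace n → Matrix.unitaryGroup ι ℂ) :
    Joint n ι →ₗᵢ[ℂ] Joint n ι where
  toFun Ψ := WithLp.toLp 2 fun q => (U q.1 : Matrix ι ι ℂ).mulVec (fun m => Ψ (q.1, m)) q.2
  map_add' Ψ Φ := by
    ext q
    exact congrFun (Matrix.mulVec_add _ (fun m => Ψ (q.1, m)) (fun m => Φ (q.1, m))) q.2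
  map_smul' a Ψ := by
    ext q
    exact congrFun (Matrix.mulVec_smul _ a (fun m => Ψ (q.1, m))) q.2
  norm_map' Ψ := by
    refine (sq_eq_sq₀ (norm_nonneg _) (norm_nonneg _)).1 ?_
    rw [Joint.norm_sq_eq, Joint.norm_sq_eq]
    exact Finset.sum_congr rfl fun A _ => sum_sq_norm_mulVec (U A) fun m => Ψ (A, m)

lemma controlled_apply (U : HalfSubspace n → Matrix.unitaryGroup ι ℂ) (Ψ : Joint n ι)
    (A : HalfSubspace n) (m : ι) :
    controlled U Ψ (A, m) = (U A : Matrix ι ι ℂ).mulVec (fun m => Ψ (A, m)) m := rfl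

/-- The joint states all of whose amplitudes, as functions of the hidden subspace, belong to
`memberSpan`. -/
noncomputable def jointSpan (n : ℕ) (ι : Type) [Fintype ι] : Submodule ℂ (Joint n ι) where
  carrier := {Ψ | ∀ m : ι, (fun A => Ψ (A, m)) ∈ memberSpan n}
  add_mem' hΨ hΦ m := add_mem (hΨ m) (hΦ m)
  zero_mem' _ := zero_mem _
  smul_mem' a _ hΨ m := Submodule.smul_mem _ a (hΨ m)

lemma controlled_const_mem (U : Matrix.unitaryGroup ι ℂ) {Ψ : Joint n ι}
    (hΨ : Ψ ∈ jointSpan n ι) : controlled (fun _ => U) Ψ ∈ jointSpan n ι := by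
  intro m
  have : (fun A => controlled (fun _ => U) Ψ (A, m)) =
      ∑ m', (U : Matrix ι ι ℂ) m m' • fun A : HalfSubspace n => Ψ (A, m') := by
    funext A
    rw [controlled_apply, Finset.sum_apply]
    rfl
  rw [this]
  exact sum_mem fun m' _ => Submodule.smul_mem _ _ (hΨ m')

end Joint

variable {n : ℕ} {W : Type} [Fintype W]

/-- The component of a joint state along `|A⟩ ⊗ |A⟩`, as a state of the other registers. -/
noncomputable def acceptMap (n : ℕ) (W : Type) [Fintype W] :
    Joint n (Memory n W) →ₗ[ℂ] Joint n (ZMod 2 × W) where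
  toFun Ψ := WithLp.toLp 2 fun q =>
    ∑ p, ketTwo q.1.1 p * Ψ (q.1, ((q.2.1, p.1), (p.2, q.2.2)))
  map_add' Ψ Φ := by
    ext q
    simp [mul_add, Finset.sum_add_distrib]
  map_smul' a Ψ := by
    ext q
    simp [Finset.mul_sum, mul_left_comm]

lemma acceptMap_apply (Ψ : Joint n (Memory n W)) (A : HalfSubspace n) (k : ZMod 2 × W) :
    acceptMap n W Ψ (A, k) = ∑ p, ketTwo A.1 p * Ψ (A, ((k.1, p.1), (p.2, k.2))) := rfl

lemma sum_memory (F : Memory n W → ℝ) :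
    ∑ m, F m = ∑ k : ZMod 2 × W, ∑ p : Str n × Str n, F ((k.1, p.1), (p.2, k.2)) := by
  rw [← Fintype.sum_prod_type']
  exact Fintype.sum_equiv
    ⟨fun m => ((m.1.1, m.2.2), (m.1.2, m.2.1)), fun t => ((t.1.1, t.2.1), (t.2.2, t.1.2)),
      fun _ => rfl, fun _ => rfl⟩ _ _ fun _ => rfl

lemma norm_acceptMap_le (Ψ : Joint n (Memory n W)) : ‖acceptMap n W Ψ‖ ≤ ‖Ψ‖ := by
  refine le_of_sq_le_sq ?_ (norm_nonneg _)
  rw [Joint.norm_sq_eq, Joint.norm_sq_eq]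
  refine Finset.sum_le_sum fun A _ => ?_
  rw [sum_memory]
  refine Finset.sum_le_sum fun k _ => ?_
  have hcs := Finset.sum_mul_sq_le_sq_mul_sq Finset.univ (fun p => ‖ketTwo A.1 p‖)
    fun p => ‖Ψ (A, ((k.1, p.1), (p.2, k.2)))‖
  rw [sum_sq_norm_ketTwo, one_mul] at hcs
  rw [acceptMap_apply]
  refine le_trans (pow_le_pow_left₀ (norm_nonneg _) (norm_sum_le _ _) 2) ?_
  simpa only [norm_mul] using hcs

lemma norm_acceptMap_le_of_mem (hn : Even n) (h6 : 6 ≤ n) {Φ : Joint n (Memory n W)}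
    (hΦ : Φ ∈ jointSpan n (Memory n W)) :
    ‖acceptMap n W Φ‖ ≤ Real.sqrt (32 / 2 ^ (n / 2)) * ‖Φ‖ := by
  refine le_of_sq_le_sq ?_ (by positivity)
  rw [mul_pow, Real.sq_sqrt (by positivity), Joint.norm_sq_eq, Joint.norm_sq_eq]
  simp_rw [sum_memory]
  rw [Finset.sum_comm, Finset.sum_comm (s := Finset.univ (α := HalfSubspace n)), Finset.mul_sum]
  refine Finset.sum_le_sum fun k _ => ?_
  rw [Finset.sum_comm (s := Finset.univ (α := HalfSubspace n))]
  exact sum_sq_norm_accept_le hn h6 (fun p A => Φ (A, ((k.1, p.1), (p.2, k.2))))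
    fun p => hΦ _

variable [DecidableEq W]

open Classical in
lemma oracle_kronecker_mulVec (A : Submodule (ZMod 2) (Str n)) (v : Memory n W → ℂ)
    (m : Memory n W) :
    (oracle A ⊗ₖ (1 : Matrix (Str n × W) (Str n × W) ℂ)).mulVec v m =
      (if m.1 ∈ starSet A then -1 else 1) * v m := by
  rw [oracle, ← Matrix.diagonal_one, Matrix.diagonal_kronecker_diagonal, Matrix.mulVec_diagonal,
    mul_one]

lemma oracle_mem_unitaryGroup (A : Submodule (ZMod 2) (Str n)) :
    oracle A ∈ Matrix.unitaryGroup (ZMod 2 × Str n) ℂ := by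
  classical
  rw [Matrix.mem_unitaryGroup_iff, oracle, Matrix.star_eq_conjTranspose,
    Matrix.diagonal_conjTranspose, Matrix.diagonal_mul_diagonal, ← Matrix.diagonal_one]
  congr 1
  funext p
  by_cases h : p ∈ starSet A <;> simp [h]

/-- A query, as a unitary of the whole memory. -/
noncomputable def queryUnitary (W : Type) [Fintype W] [DecidableEq W]
    (A : Submodule (ZMod 2) (Str n)) : Matrix.unitaryGroup (Memory n W) ℂ :=
  ⟨oracle A ⊗ₖ (1 : Matrix (Str n × W) (Str n × W) ℂ),
    Matrix.kronecker_mem_unitary (oracle_mem_unitaryGroup A) (one_mem _)⟩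

lemma exists_near_query (hn : Even n) (h6 : 6 ≤ n) (U : Matrix.unitaryGroup (Memory n W) ℂ)
    {Φ : Joint n (Memory n W)} (hΦ : Φ ∈ jointSpan n (Memory n W)) :
    ∃ Φ' ∈ jointSpan n (Memory n W),
      ‖controlled (fun _ => U) (controlled (fun A => queryUnitary W A.1) Φ) - Φ'‖ ≤
        Real.sqrt (16 / 2 ^ (n / 2)) * ‖Φ‖ := by
  classical
  choose g hg hle using fun m => exists_near_oracle hn h6 (hΦ m) m.1
  have hmem : WithLp.toLp 2 (fun q : HalfSubspace n × Memory n W => g q.2 q.1) ∈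
      jointSpan n (Memory n W) := hg
  refine ⟨_, controlled_const_mem U hmem, ?_⟩
  rw [← map_sub, LinearIsometry.norm_map]
  refine le_of_sq_le_sq ?_ (by positivity)
  rw [mul_pow, Real.sq_sqrt (by positivity), Joint.norm_sq_eq, Joint.norm_sq_eq,
    Finset.sum_comm, Finset.sum_comm (s := Finset.univ (α := HalfSubspace n)), Finset.mul_sum]
  refine Finset.sum_le_sum fun m _ => le_of_eq_of_le (Finset.sum_congr rfl fun A _ => ?_) (hle m)
  rw [PiLp.sub_apply, controlled_apply]
  exact congrArg (fun z => ‖z - g m A‖ ^ 2) (oracle_kronecker_mulVec A.1 _ m)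

/-! ### The query lower bound -/

namespace Counterfeiter

/-- The joint state after `t` queries, for a uniform superposition of the hidden subspaces. It is
not normalized: its squared norm is the number of subspaces. -/
noncomputable def joint (C : Counterfeiter n) (t : ℕ) : Joint n (Memory n C.Work) :=
  WithLp.toLp 2 fun q => C.stateAfter q.1.1 t q.2

/-- A query followed by the next gate. -/
noncomputable def step (C : Counterfeiter n) (t : ℕ) :
    Joint n (Memory n C.Work) →ₗᵢ[ℂ] Joint n (Memory n C.Work) :=
  (controlled fun _ => C.gate (t + 1)).comp (controlled fun A => queryUnitary C.Work A.1)

lemma joint_succ (C : Counterfeiter n) (t : ℕ) : C.joint (t + 1) = C.step t (C.joint t) := rfl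

lemma exists_near_step (hn : Even n) (h6 : 6 ≤ n) (C : Counterfeiter n) (t : ℕ)
    (Φ : Joint n (Memory n C.Work)) (hΦ : Φ ∈ jointSpan n (Memory n C.Work)) :
    ∃ Φ' ∈ jointSpan n (Memory n C.Work),
      ‖C.step t Φ - Φ'‖ ≤ Real.sqrt (16 / 2 ^ (n / 2)) * ‖Φ‖ := by
  simp only [step, LinearIsometry.coe_comp, Function.comp_apply]
  exact exists_near_query hn h6 (C.gate (t + 1)) hΦ

lemma joint_zero (C : Counterfeiter n) : C.joint 0 = controlled (fun _ => C.gate 0)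
    (WithLp.toLp 2 fun q => C.initial q.1.1 q.2) := rfl

lemma joint_zero_mem (C : Counterfeiter n) : C.joint 0 ∈ jointSpan n (Memory n C.Work) := by
  rw [joint_zero]
  refine controlled_const_mem _ fun m => ?_
  by_cases h : m.1.1 = 0 ∧ m.2.1 = 0 ∧ m.2.2 = C.start
  · have : (fun A : HalfSubspace n => C.initial A.1 m) =
        (((Real.sqrt (2 ^ (n / 2)))⁻¹ : ℝ) : ℂ) •
          fun A : HalfSubspace n => (ind m.1.2 A.1 : ℂ) := by
      funext A
      simp only [initial, h, and_self, if_true, ket_eq]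
      push_cast
      rfl
    exact this ▸ Submodule.smul_mem _ _ (ind_mem_memberSpan _)
  · have : (fun A : HalfSubspace n => C.initial A.1 m) = 0 := by
      funext A
      simp only [initial, h, if_false, Pi.zero_apply]
    exact this ▸ zero_mem _

lemma norm_sq_joint_zero (C : Counterfeiter n) :
    ‖C.joint 0‖ ^ 2 = Fintype.card (HalfSubspace n) := by
  rw [joint_zero, LinearIsometry.norm_map, Joint.norm_sq_eq]
  have (A : HalfSubspace n) : ∑ m, ‖C.initial A.1 m‖ ^ 2 = 1 := by
    rw [← sum_sq_norm_ket A]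
    refine (Finset.sum_of_injOn (fun x => ((0, x), (0, C.start))) ?_ ?_ ?_ ?_).symm
    · intro x _ y _ h
      simpa using h
    · intro x _
      simp
    · rintro ⟨⟨b, x⟩, ⟨y, w⟩⟩ _ h
      have : ¬ (b = 0 ∧ y = 0 ∧ w = C.start) := by
        rintro ⟨rfl, rfl, rfl⟩
        exact h ⟨x, by simp, rfl⟩
      simp [initial, this]
    · intro x _
      simp [initial]
  simp only [this]
  simp

lemma acceptProb_eq_overlap (C : Counterfeiter n) (A : Submodule (ZMod 2) (Str n)) :
    C.acceptProb A = C.overlap A := by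
  have h : verifierTwo A = Matrix.vecMulVec (ketTwo A) (star (ketTwo A)) := by
    ext p q
    simp [verifierTwo, verifier, ketTwo, Matrix.vecMulVec_apply]
    ring
  rw [acceptProb, overlap, h, Matrix.trace_mul_comm, Matrix.mul_vecMulVec,
    Matrix.trace_vecMulVec, dotProduct_comm]

lemma overlap_eq (C : Counterfeiter n) (A : HalfSubspace n) :
    C.overlap A.1 = ∑ k, ‖acceptMap n C.Work (C.joint C.queries) (A, k)‖ ^ 2 := by
  have hstar : star (ketTwo A.1) = ketTwo A.1 := by
    funext p
    rw [Pi.star_apply, ketTwo_eq]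
    exact Complex.conj_ofReal _
  let F : ZMod 2 × C.Work → Str n × Str n → ℂ := fun k p =>
    C.final A.1 ((k.1, p.1), (p.2, k.2))
  have hout : C.output A.1 = ∑ k, Matrix.vecMulVec (F k) (star (F k)) := by
    ext p q
    simp [output, Matrix.sum_apply, Matrix.vecMulVec_apply, Fintype.sum_prod_type, F]
  have : star (ketTwo A.1) ⬝ᵥ (C.output A.1).mulVec (ketTwo A.1) =
      ((∑ k, ‖acceptMap n C.Work (C.joint C.queries) (A, k)‖ ^ 2 : ℝ) : ℂ) := by
    rw [hout, Matrix.sum_mulVec, dotProduct_sum, Complex.ofReal_sum]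
    refine Finset.sum_congr rfl fun k _ => ?_
    have hamp : acceptMap n C.Work (C.joint C.queries) (A, k) = ketTwo A.1 ⬝ᵥ F k := rfl
    have hconj : star (F k) ⬝ᵥ ketTwo A.1 = star (ketTwo A.1 ⬝ᵥ F k) := by
      rw [Matrix.star_dotProduct, hstar]
    rw [hamp, Matrix.vecMulVec_mulVec, dotProduct_smul, hstar, hconj, Complex.ofReal_pow]
    exact Complex.mul_conj' _
  rw [overlap, this, Complex.ofReal_re]

/-- The quantitative bound: each query adds `4 / √Q` to the amplitude of acceptance, where
`Q = 2 ^ (n / 2)`, and without queries it is at most `6 / √Q`. -/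
lemma averageAcceptProb_le (hn : Even n) (h6 : 6 ≤ n) (C : Counterfeiter n) :
    C.averageAcceptProb ≤ (6 + 4 * C.queries) ^ 2 / 2 ^ (n / 2) := by
  obtain ⟨Φ, hΦ, hle, hdist⟩ := exists_near_iterate (jointSpan n (Memory n C.Work))
    (Real.sqrt_nonneg (16 / 2 ^ (n / 2))) C.step (C.exists_near_step hn h6) C.joint
    C.joint_zero_mem C.joint_succ C.queries
  set T : ℝ := (C.queries : ℝ)
  set N : ℝ := (Fintype.card (HalfSubspace n) : ℝ) with hN
  set r : ℝ := Real.sqrt (2 ^ (n / 2)) with hr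
  have hr0 : 0 < r := Real.sqrt_pos.2 (by positivity)
  have hr2 : r ^ 2 = 2 ^ (n / 2) := Real.sq_sqrt (by positivity)
  have h16 : Real.sqrt (16 / 2 ^ (n / 2)) = 4 / r := by
    rw [Real.sqrt_div (by norm_num), show (16 : ℝ) = 4 ^ 2 by norm_num,
      Real.sqrt_sq (by norm_num)]
  have h32 : Real.sqrt (32 / 2 ^ (n / 2)) ≤ 6 / r := by
    rw [Real.sqrt_div (by norm_num)]
    gcongr
    rw [Real.sqrt_le_iff]
    norm_num
  have hamp : ‖acceptMap n C.Work (C.joint C.queries)‖ ≤ (6 + 4 * T) / r * ‖C.joint 0‖ := by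
    calc _ = ‖acceptMap n C.Work Φ + acceptMap n C.Work (C.joint C.queries - Φ)‖ := by
          rw [← map_add, add_sub_cancel]
      _ ≤ Real.sqrt (32 / 2 ^ (n / 2)) * ‖Φ‖ + ‖C.joint C.queries - Φ‖ :=
          (norm_add_le _ _).trans
            (add_le_add (norm_acceptMap_le_of_mem hn h6 hΦ) (norm_acceptMap_le _))
      _ ≤ 6 / r * ‖C.joint 0‖ + T * (4 / r) * ‖C.joint 0‖ := by
          rw [← h16]
          gcongr
      _ = _ := by ring
  have hsum : ∑ A : HalfSubspace n, C.acceptProb A.1 ≤ (6 + 4 * T) ^ 2 / 2 ^ (n / 2) * N := by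
    simp_rw [acceptProb_eq_overlap, overlap_eq]
    rw [← Joint.norm_sq_eq, hN, ← C.norm_sq_joint_zero, ← hr2, ← div_pow, ← mul_pow]
    exact pow_le_pow_left₀ (norm_nonneg _) hamp 2
  exact div_le_of_le_mul₀ (Nat.cast_nonneg _) (by positivity) hsum

lemma le_averageAcceptProb {ε : ℝ} (C : Counterfeiter n)
    (h : ∀ A : HalfSubspace n, ε ≤ C.overlap A.1) : ε ≤ C.averageAcceptProb := by
  obtain ⟨v, hv⟩ := exists_linearIndependent_of_le_finrank (R := ZMod 2) (M := Str n)
    (n := n / 2) (by simpa using Nat.div_le_self n 2)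
  have : Nonempty (HalfSubspace n) :=
    ⟨⟨Submodule.span (ZMod 2) (Set.range v), by simpa using finrank_span_eq_card hv⟩⟩
  have hN : (0 : ℝ) < Fintype.card (HalfSubspace n) := Nat.cast_pos.2 Fintype.card_pos
  rw [averageAcceptProb, le_div_iff₀ hN, mul_comm, ← nsmul_eq_mul, ← Finset.card_univ]
  exact Finset.card_nsmul_le_sum _ _ _ fun A _ => (h A).trans_eq (C.acceptProb_eq_overlap A.1).symm

lemma overlap_eq_one (C : Counterfeiter n) (A : HalfSubspace n)
    (h : C.output A.1 = Matrix.vecMulVec (ketTwo A.1) (star (ketTwo A.1))) :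
    C.overlap A.1 = 1 := by
  have h1 : star (ketTwo A.1) ⬝ᵥ ketTwo A.1 = 1 := by
    have := sum_sq_norm_ketTwo A
    rw [dotProduct]
    have h2 : ((∑ p, ‖ketTwo A.1 p‖ ^ 2 : ℝ) : ℂ) = 1 := by rw [this]; simp
    rw [← h2]
    push_cast
    exact Finset.sum_congr rfl fun m _ => Complex.conj_mul' _
  rw [overlap, h, Matrix.vecMulVec_mulVec, h1]
  simp [h1]

/-- The hypothesis on `ε` absorbs the additive constant of `averageAcceptProb_le`, that is, the
acceptance probability reached without any query. -/
lemma queries_ge {ε : ℝ} (hn : Even n) (h6 : 6 ≤ n) (hε : 144 ≤ ε * 2 ^ (n / 2))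
    (C : Counterfeiter n) (h : ε ≤ C.averageAcceptProb) :
    1 / 8 * (Real.sqrt ε * (2 : ℝ) ^ ((n : ℝ) / 4)) ≤ C.queries := by
  have hroot : Real.sqrt ε * (2 : ℝ) ^ ((n : ℝ) / 4) = Real.sqrt (ε * 2 ^ (n / 2)) := by
    rw [Real.sqrt_mul' _ (by positivity)]
    congr 1
    rw [Real.sqrt_eq_rpow, ← Real.rpow_natCast, ← Real.rpow_mul (by norm_num)]
    congr 1
    obtain ⟨k, rfl⟩ := hn
    rw [← two_mul, Nat.mul_div_cancel_left _ (by norm_num)]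
    push_cast
    ring
  have h1 := h.trans (averageAcceptProb_le hn h6 C)
  rw [le_div_iff₀ (by positivity)] at h1
  have h2 : Real.sqrt (ε * 2 ^ (n / 2)) ≤ 6 + 4 * C.queries :=
    Real.sqrt_le_iff.2 ⟨by positivity, h1⟩
  have h3 : 12 ≤ Real.sqrt (ε * 2 ^ (n / 2)) := Real.le_sqrt_of_sq_le (by linarith)
  rw [hroot]
  linarith

end Counterfeiter

/-- The average case, from which the worst cases follow. -/
lemma eventually_queries_ge {ε : ℕ → ℝ} (hε : ∀ n, 0 < ε n)
    (ho : (fun n : ℕ => 1 / ε n) =o[atTop] (fun n : ℕ => (2 : ℝ) ^ ((n : ℝ) / 2))) :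
    ∀ᶠ n : ℕ in atTop, Even n → ∀ C : Counterfeiter n, ε n ≤ C.averageAcceptProb →
      1 / 8 * (Real.sqrt (ε n) * (2 : ℝ) ^ ((n : ℝ) / 4)) ≤ (C.queries : ℝ) := by
  filter_upwards [ho.def (c := 1 / 144) (by norm_num), eventually_ge_atTop 6] with n h h6 hn C hC
  refine C.queries_ge hn h6 ?_ hC
  have hpow : (2 : ℝ) ^ ((n : ℝ) / 2) = 2 ^ (n / 2) := by
    rw [← Real.rpow_natCast]
    congr 1
    obtain ⟨k, rfl⟩ := hn
    rw [← two_mul, Nat.mul_div_cancel_left _ (by norm_num)]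
    push_cast
    ring
  rw [hpow, Real.norm_of_nonneg (by have := hε n; positivity), Real.norm_of_nonneg (by positivity),
    div_le_iff₀ (hε n)] at h
  linarith

end SubspaceMoney

theorem theorem5p4 :
    -- perfect counterfeiting, worst case
    (∃ c : ℝ, 0 < c ∧ ∀ᶠ n : ℕ in atTop, Even n →
      ∀ C : SubspaceMoney.Counterfeiter n,
        (∀ A : SubspaceMoney.HalfSubspace n,
          C.output A.1 = Matrix.vecMulVec (SubspaceMoney.ketTwo A.1)
            (star (SubspaceMoney.ketTwo A.1))) →
        c * (2 : ℝ) ^ ((n : ℝ) / 4) ≤ (C.queries : ℝ)) ∧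
    -- small-error counterfeiting, worst case
    (∃ c : ℝ, 0 < c ∧ ∀ᶠ n : ℕ in atTop, Even n →
      ∀ C : SubspaceMoney.Counterfeiter n,
        (∀ A : SubspaceMoney.HalfSubspace n, (0.9999 : ℝ) ≤ C.overlap A.1) →
        c * (2 : ℝ) ^ ((n : ℝ) / 4) ≤ (C.queries : ℝ)) ∧
    -- high-error counterfeiting, worst case
    (∃ c : ℝ, 0 < c ∧ ∀ ε : ℕ → ℝ, (∀ n, 0 < ε n) →
      (fun n : ℕ => 1 / ε n) =o[atTop] (fun n : ℕ => (2 : ℝ) ^ ((n : ℝ) / 2)) →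
      ∀ᶠ n : ℕ in atTop, Even n →
        ∀ C : SubspaceMoney.Counterfeiter n,
          (∀ A : SubspaceMoney.HalfSubspace n, ε n ≤ C.overlap A.1) →
          c * (Real.sqrt (ε n) * (2 : ℝ) ^ ((n : ℝ) / 4)) ≤ (C.queries : ℝ)) ∧
    -- average-case counterfeiting
    (∃ c : ℝ, 0 < c ∧ ∀ ε : ℕ → ℝ, (∀ n, 0 < ε n) →
      (fun n : ℕ => 1 / ε n) =o[atTop] (fun n : ℕ => (2 : ℝ) ^ ((n : ℝ) / 2)) →
      ∀ᶠ n : ℕ in atTop, Even n →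
        ∀ C : SubspaceMoney.Counterfeiter n,
          ε n ≤ C.averageAcceptProb →
          c * (Real.sqrt (ε n) * (2 : ℝ) ^ ((n : ℝ) / 4)) ≤ (C.queries : ℝ)) := by
  have hworst := fun {ε : ℕ → ℝ} (hε : ∀ n, 0 < ε n)
    (ho : (fun n : ℕ => 1 / ε n) =o[atTop] (fun n : ℕ => (2 : ℝ) ^ ((n : ℝ) / 2))) =>
    (SubspaceMoney.eventually_queries_ge hε ho).mono fun n h hn
      (C : SubspaceMoney.Counterfeiter n)
      (hC : ∀ A : SubspaceMoney.HalfSubspace n, ε n ≤ C.overlap A.1) =>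
        h hn C (C.le_averageAcceptProb hC)
  have hsmall : ∀ᶠ n : ℕ in atTop, Even n → ∀ C : SubspaceMoney.Counterfeiter n,
      (∀ A : SubspaceMoney.HalfSubspace n, (0.9999 : ℝ) ≤ C.overlap A.1) →
        1 / 8 * Real.sqrt 0.9999 * (2 : ℝ) ^ ((n : ℝ) / 4) ≤ (C.queries : ℝ) := by
    have hto : Tendsto (fun n : ℕ => ‖(2 : ℝ) ^ ((n : ℝ) / 2)‖) atTop atTop := by
      refine tendsto_norm_atTop_atTop.comp ?_
      exact (tendsto_rpow_atTop_of_base_gt_one 2 (by norm_num)).comp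
        (tendsto_natCast_atTop_atTop.atTop_div_const (by norm_num))
    refine (hworst (ε := fun _ => 0.9999) (fun _ => by norm_num)
      (isLittleO_const_left.2 (Or.inr hto))).mono fun n h hn C hC => ?_
    rw [mul_assoc]
    exact h hn C hC
  have hpos : 0 < 1 / 8 * Real.sqrt 0.9999 := by positivity
  refine ⟨⟨_, hpos, hsmall.mono fun n h hn C hC => h hn C fun A => ?_⟩, ⟨_, hpos, hsmall⟩,
    ⟨1 / 8, by norm_num, fun ε hε ho => hworst hε ho⟩,
    ⟨1 / 8, by norm_num, fun ε hε ho => SubspaceMoney.eventually_queries_ge hε ho⟩⟩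
  rw [C.overlap_eq_one A (hC A)]
  norm_num
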